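/- All systems are finite-dimensional Hilbert spaces with fixed standard bases, of dimension at least one; $|X|$ denotes the dimension of $X$, transposes are taken in the standard bases, $M\cdot\rho := M\rho M^\dagger$, $\|M\| := \operatorname{tr}|M|$ is the trace norm, $\Phi=|\Phi\rangle\langle\Phi|$ for a unit vector $|\Phi\rangle$ (and similarly for other vectors), a superscript on a state denotes its reduced state on these systems, and operators are tacitly extended by the identity. For systems $S,S'$ of equal dimension, $|\Phi\rangle^{SS'} = |S|^{-1/2}\sum_{i=1}^{|S|}|i\rangle^S|i\rangle^{S'}$. Let $\mathcal N^{A'\to B_1B_2}$ be a quantum broadcast channel (a completely positive trace-preserving map with two output systems) and let $U_{\mathcal N}^{A'\to B_1B_2E}$ be an isometric extension of it, that is, an isometry with $\mathcal N(\rho)=\operatorname{tr}_E[U_{\mathcal N}\cdot\rho]$. For $i=1,2$ let $R_i, A_i, \bar B_i$ be systems of equal dimension and let $\tilde A_i,\tilde B_i$ be systems of equal dimension. Put $$|\varphi\rangle = |\Phi\rangle^{R_1A_1}\otimes|\Phi\rangle^{\tilde A_1\tilde B_1}\otimes|\Phi\rangle^{R_2A_2}\otimes|\Phi\rangle^{\tilde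 A_2\tilde B_2}.$$ Then for every encoding isometry $W^{A_1\tilde A_1A_2\tilde A_2\to A'\hat A}$ there exist unitaries $U_1$ on $A_1\tilde A_1$ and $U_2$ on $A_2\tilde A_2$, finite-dimensional systems $\hat B_1,\hat B_2$, and decoding isometries $V_1^{B_1\tilde B_1\to\bar B_1\hat B_1}$ and $V_2^{B_2\tilde B_2\to\bar B_2\hat B_2}$, and a pure state $\hat\psi^{\hat B_1\hat B_2E\hat A}$, such that $$\Big\|\,(V_2V_1U_{\mathcal N}WU_2^TU_1^T)\cdot\varphi-\hat\psi^{\hat B_1\hat B_2E\hat A}\otimes\Phi^{R_1\bar B_1}\otimes\Phi^{R_2\bar B_2}\Big\|$$ $$\le 4\left\{\frac{|R_1||\tilde B_1||R_2\tilde B_2B_2E\hat A|}{|\tilde B_1|^2}\operatorname{tr}\big[(\psi^{R_1\tilde B_1R_2\tilde B_2B_2E\hat A})^2\big]\right\}^{1/4}+2\left\{\frac{|R_2||\tilde B_2||R_1\tilde B_1B_1E\hat A|}{|\tilde B_2|^2}\operatorname{tr}\big[(\psi^{R_2\tilde B_2R_1\tilde B_1B_1E\hat A})^2\big]\right\}^{1/4},$$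 where $|\psi\rangle=U_{\mathcal N}W|\varphi\rangle$. Moreover $\hat\psi$ is uniquely determined by the protocol $(U_1,U_2,V_1,V_2)$: it is the only pure state on $\hat B_1\hat B_2E\hat A$ for which the left-hand side is minimal among all pure states. -/

import Mathlib

open scoped Matrix Kronecker

noncomputable section

namespace BroadcastFather

/-! Finite-dimensional quantum systems are represented by finite types labelling their standard
bases: the Hilbert space of `X` is `X → ℂ`, of dimension `Fintype.card X`; the composite of `X` and
`Y` is labelled by `X × Y`; operators are matrices in the standard bases. -/

/-- The matrix `V` is an isometry from the system `X` to the system `Y`. -/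
def IsIsometry {X Y : Type*} [Fintype Y] [DecidableEq X] (V : Matrix Y X ℂ) : Prop :=
  Vᴴ * V = 1

/-- The operator `|v⟩⟨v|`. -/
def ketBra {X : Type*} (v : X → ℂ) : Matrix X X ℂ :=
  Matrix.vecMulVec v (star v)

/-- `ρ` is (the density operator of) a pure state. -/
def IsPureState {X : Type*} [Fintype X] (ρ : Matrix X X ℂ) : Prop :=
  ∃ v : X → ℂ, star v ⬝ᵥ v = 1 ∧ ρ = ketBra v

/-- Partial trace over the second tensor factor. -/
def partialTrace {X Y : Type*} [Fintype Y] (ρ : Matrix (X × Y) (X × Y) ℂ) : Matrix X X ℂ :=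
  Matrix.of fun i j => ∑ k, ρ (i, k) (j, k)

/-- The purity `tr[ρ²]` (a real number for Hermitian `ρ`). -/
def purity {X : Type*} [Fintype X] (ρ : Matrix X X ℂ) : ℝ :=
  (ρ * ρ).trace.re

open scoped MatrixOrder in
/-- The trace norm `tr |M|`, with `|M| = √(Mᴴ M)`. -/
def traceNorm {X : Type*} [Fintype X] [DecidableEq X] (M : Matrix X X ℂ) : ℝ :=
  (CFC.abs M).trace.re

/-- The standard maximally entangled vector `|Φ⟩ = |S|^{-1/2} ∑ᵢ |i i⟩` on two copies of `S`. -/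
def maxEnt (S : Type*) [Fintype S] [DecidableEq S] : S × S → ℂ :=
  fun p => if p.1 = p.2 then ((1 / √(Fintype.card S : ℝ) : ℝ) : ℂ) else 0

/-- The linear map `N ⊗ id_Z`. -/
def ampliation {X Y : Type*} (N : Matrix X X ℂ →ₗ[ℂ] Matrix Y Y ℂ) (Z : Type*)
    (M : Matrix (X × Z) (X × Z) ℂ) : Matrix (Y × Z) (Y × Z) ℂ :=
  Matrix.of fun p q => N (Matrix.of fun i j => M (i, p.2) (j, q.2)) p.1 q.1

open scoped ComplexOrder in
/-- `N` is a quantum channel: a completely positive trace-preserving map. -/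
def IsQuantumChannel {X Y : Type*} [Fintype X] [Fintype Y]
    (N : Matrix X X ℂ →ₗ[ℂ] Matrix Y Y ℂ) : Prop :=
  (∀ (k : ℕ) (M : Matrix (X × Fin k) (X × Fin k) ℂ),
    M.PosSemidef → (ampliation N (Fin k) M).PosSemidef) ∧
  ∀ ρ : Matrix X X ℂ, (N ρ).trace = ρ.trace

/-- `U` is an isometric extension of the channel `N`, with environment `E`. -/
def IsIsometricExtension {X Y E : Type*} [Fintype X] [DecidableEq X] [Fintype Y] [Fintype E]
    (N : Matrix X X ℂ →ₗ[ℂ] Matrix Y Y ℂ) (U : Matrix (Y × E) X ℂ) : Prop :=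
  IsIsometry U ∧ ∀ ρ : Matrix X X ℂ, N ρ = partialTrace (U * ρ * Uᴴ)

section Protocol

/-! For `i = 1, 2` the label type `Kᵢ` is used for the systems `Rᵢ`, `Aᵢ` and (after decoding) `B̄ᵢ`,
which have equal size and identified standard bases; likewise `Tᵢ` labels `Ãᵢ` and `B̃ᵢ`. `C` labels
the system `Â` kept by the sender, `D₁`, `D₂` label `B̂₁`, `B̂₂`. -/

variable {K₁ T₁ K₂ T₂ A' C B₁ B₂ E D₁ D₂ : Type*}
  [Fintype K₁] [DecidableEq K₁] [Fintype T₁] [DecidableEq T₁]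
  [Fintype K₂] [DecidableEq K₂] [Fintype T₂] [DecidableEq T₂]
  [Fintype A'] [DecidableEq A'] [Fintype C] [DecidableEq C]
  [Fintype B₁] [DecidableEq B₁] [Fintype B₂] [DecidableEq B₂] [Fintype E] [DecidableEq E]
  [Fintype D₁] [DecidableEq D₁] [Fintype D₂] [DecidableEq D₂]

/-- `|φ⟩ = |Φ⟩^{R₁A₁} ⊗ |Φ⟩^{Ã₁B̃₁} ⊗ |Φ⟩^{R₂A₂} ⊗ |Φ⟩^{Ã₂B̃₂}`, with the systems in the order
`((R₁B̃₁)(R₂B̃₂)) ((A₁Ã₁)(A₂Ã₂))`. -/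
def inputState (K₁ T₁ K₂ T₂ : Type*) [Fintype K₁] [DecidableEq K₁] [Fintype T₁] [DecidableEq T₁]
    [Fintype K₂] [DecidableEq K₂] [Fintype T₂] [DecidableEq T₂] :
    ((K₁ × T₁) × (K₂ × T₂)) × ((K₁ × T₁) × (K₂ × T₂)) → ℂ :=
  fun ⟨⟨⟨r₁, b₁⟩, ⟨r₂, b₂⟩⟩, ⟨⟨a₁, t₁⟩, ⟨a₂, t₂⟩⟩⟩ =>
    maxEnt K₁ (r₁, a₁) * maxEnt T₁ (t₁, b₁) * maxEnt K₂ (r₂, a₂) * maxEnt T₂ (t₂, b₂)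

/-- `U_N W G |φ⟩`, where `G` acts on the sender's systems `(A₁Ã₁)(A₂Ã₂)`. The systems of the result
are in the order `((R₁B̃₁)(R₂B̃₂)) (((B₁B₂)E)Â)`. -/
def transmitted (U : Matrix ((B₁ × B₂) × E) A' ℂ)
    (W : Matrix (A' × C) ((K₁ × T₁) × (K₂ × T₂)) ℂ)
    (G : Matrix ((K₁ × T₁) × (K₂ × T₂)) ((K₁ × T₁) × (K₂ × T₂)) ℂ) :
    ((K₁ × T₁) × (K₂ × T₂)) × (((B₁ × B₂) × E) × C) → ℂ :=
  ((1 : Matrix ((K₁ × T₁) × (K₂ × T₂)) ((K₁ × T₁) × (K₂ × T₂)) ℂ) ⊗ₖ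
    ((U ⊗ₖ (1 : Matrix C C ℂ)) * W * G)) *ᵥ inputState K₁ T₁ K₂ T₂

/-- The reduced state on `R₁B̃₁R₂B̃₂B₂EÂ` of a pure state of all the transmitted systems
(everything except the channel output `B₁`). -/
def reduced₁ (v : ((K₁ × T₁) × (K₂ × T₂)) × (((B₁ × B₂) × E) × C) → ℂ) :
    Matrix ((K₁ × T₁) × (K₂ × T₂ × B₂ × E × C)) ((K₁ × T₁) × (K₂ × T₂ × B₂ × E × C)) ℂ :=
  partialTrace (Y := B₁) <| ketBra fun ⟨⟨⟨r₁, t₁⟩, ⟨r₂, t₂, b₂, e, c⟩⟩, b₁⟩ =>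
    v (((r₁, t₁), (r₂, t₂)), (((b₁, b₂), e), c))

/-- The reduced state on `R₂B̃₂R₁B̃₁B₁EÂ` of a pure state of all the transmitted systems
(everything except the channel output `B₂`). -/
def reduced₂ (v : ((K₁ × T₁) × (K₂ × T₂)) × (((B₁ × B₂) × E) × C) → ℂ) :
    Matrix ((K₂ × T₂) × (K₁ × T₁ × B₁ × E × C)) ((K₂ × T₂) × (K₁ × T₁ × B₁ × E × C)) ℂ :=
  partialTrace (Y := B₂) <| ketBra fun ⟨⟨⟨r₂, t₂⟩, ⟨r₁, t₁, b₁, e, c⟩⟩, b₂⟩ =>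
    v (((r₁, t₁), (r₂, t₂)), (((b₁, b₂), e), c))

/-- `V₂ V₁ |v⟩`, where `V₁` acts on `B₁B̃₁` and `V₂` on `B₂B̃₂`. The systems of the result are in the
order `((R₁B̄₁)(R₂B̄₂)) (B̂₁B̂₂EÂ)`. -/
def decoded (V₁ : Matrix (K₁ × D₁) (B₁ × T₁) ℂ) (V₂ : Matrix (K₂ × D₂) (B₂ × T₂) ℂ)
    (v : ((K₁ × T₁) × (K₂ × T₂)) × (((B₁ × B₂) × E) × C) → ℂ) :
    ((K₁ × K₁) × (K₂ × K₂)) × (D₁ × D₂ × E × C) → ℂ :=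
  fun ⟨⟨⟨r₁, k₁⟩, ⟨r₂, k₂⟩⟩, ⟨d₁, d₂, e, c⟩⟩ =>
    ((V₁ ⊗ₖ V₂) *ᵥ fun ⟨⟨b₁, t₁⟩, ⟨b₂, t₂⟩⟩ => v (((r₁, t₁), (r₂, t₂)), (((b₁, b₂), e), c)))
      ((k₁, d₁), (k₂, d₂))

/-- The trace distance between the final state
`(V₂ V₁ U_N W U₂ᵀ U₁ᵀ) · φ` of the protocol and `Φ^{R₁B̄₁} ⊗ Φ^{R₂B̄₂} ⊗ χ`. -/
def protocolError (U : Matrix ((B₁ × B₂) × E) A' ℂ)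
    (W : Matrix (A' × C) ((K₁ × T₁) × (K₂ × T₂)) ℂ)
    (U₁ : Matrix (K₁ × T₁) (K₁ × T₁) ℂ) (U₂ : Matrix (K₂ × T₂) (K₂ × T₂) ℂ)
    (V₁ : Matrix (K₁ × D₁) (B₁ × T₁) ℂ) (V₂ : Matrix (K₂ × D₂) (B₂ × T₂) ℂ)
    (χ : Matrix (D₁ × D₂ × E × C) (D₁ × D₂ × E × C) ℂ) : ℝ :=
  traceNorm (ketBra (decoded V₁ V₂ (transmitted U W (U₁ᵀ ⊗ₖ U₂ᵀ))) -
    (ketBra (maxEnt K₁) ⊗ₖ ketBra (maxEnt K₂)) ⊗ₖ χ)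

end Protocol

end BroadcastFather

end

/-! The two receivers are treated independently, starting from the same state `ψ`, and then combined
by a union bound.

Transpose trick: since `φ` is maximally entangled between the sender and `R₁B̃₁R₂B̃₂`, applying
`U₁ᵀ`, `U₂ᵀ` at the sender amounts to applying `U₁`, `U₂` to `R₁B̃₁`, `R₂B̃₂` in `ψ`
(`transmitted_transpose`). The task for one receiver is therefore to find a unitary on `R B̃` after
which `R` is nearly maximally mixed and uncorrelated with the systems `X` that this receiver lacks.

Decoupling (`exists_unitary_marginalSq_le`): a finite ensemble of products of diagonal phases, a
permutation, a flat unitary and further diagonal phases satisfies the second-moment bound needed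
here, so no Haar integral is required. It bounds the squared Hilbert–Schmidt distance between the
reduced state on `R X` and `π ⊗ ψ^X` by the purity on `R B̃ X` divided by `|B̃|`.

Decoding (`exists_contraction_overlap`): a form of Uhlmann's theorem, with fidelity replaced by `tr
√ρ √σ` and controlled by Powers–Størmer, yields a contraction on the receiver's systems, which is
dilated to an isometry. The weight of the decoded state on `Φ^{R B̄}` is then at least `1 - √Δ`,
with `Δ` the quantity under the fourth root (`exists_unitary_isometry_overlap`).

Combination: the operations of the two receivers commute and preserve norms, so neither disturbs the
other's weight. For the commuting projections onto the two maximally entangled states, the joint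
weight is at least `1 - √Δ₁ - √Δ₂` (`norm_sq_overlap_ge`). The closest pure state of the remaining
systems is the normalized component along `Φ ⊗ Φ`; it is unique when that component is nonzero, and
the error is `2√(1 - weight)` (`exists_unique_nearest_pure`). This gives at most `2 Δ₁^{1/4} + 2
Δ₂^{1/4}`, slightly better than required. When `√Δ₁ + √Δ₂ ≥ 1` the bound is trivial, but uniqueness
still demands a protocol not orthogonal to the target, which is built by hand. -/

noncomputable section

namespace BroadcastFather

open scoped ComplexConjugate

/-! ### Moments of random phases and random permutations; a flat unitary. -/

section Twirl

/-- The fourth roots of unity. -/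
def phase (a : Fin 4) : ℂ := Complex.I ^ (a : ℕ)

theorem phase_add_one (a : Fin 4) : phase (a + 1) = Complex.I * phase a := by
  fin_cases a <;> simp [phase, pow_succ]

theorem phase_mul_conj (a : Fin 4) : phase a * conj (phase a) = 1 := by
  rw [Complex.mul_conj']; simp [phase]

theorem phase_add_single {ι : Type*} [DecidableEq ι] (z : ι → Fin 4) (i j : ι) :
    phase ((z + Pi.single i 1 : ι → Fin 4) j) = (if j = i then Complex.I else 1) * phase (z j) := by
  by_cases h : j = i
  · subst h; simp [phase_add_one]
  · simp [h]

variable {ι : Type*} [Fintype ι] [DecidableEq ι]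

theorem sum_eq_zero_of_shift (f : (ι → Fin 4) → ℂ) (i : ι) (c : ℂ) (hc : c ≠ 1)
    (h : ∀ z, f (z + Pi.single i 1) = c * f z) : ∑ z, f z = 0 := by
  have h1 : ∑ z, f (z + Pi.single i 1) = ∑ z, f z :=
    Fintype.sum_equiv (Equiv.addRight (Pi.single i (1 : Fin 4))) _ _ fun _ => rfl
  simp_rw [h, ← Finset.mul_sum] at h1
  have h2 : (c - 1) * ∑ z, f z = 0 := by linear_combination h1
  exact (mul_eq_zero.1 h2).resolve_left (sub_ne_zero.2 hc)

/-- An unbalanced index can be shifted, which multiplies the sum by a factor other than 1, so only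
pairings of a phase with a conjugate survive. Fourth roots are used because random signs would also
keep the pairing `j = m`, `k = l`: there the shift gives `I * I = -1`, whereas signs would give `1`.
The subtracted term corrects double counting when all four indices agree. -/
theorem sum_phase_moment (j k l m : ι) :
    ∑ z : ι → Fin 4, phase (z j) * conj (phase (z k)) * (conj (phase (z l)) * phase (z m)) =
      (Fintype.card (ι → Fin 4) : ℂ) *
        ((if j = k then if l = m then 1 else 0 else 0) +
          (if j = l then if k = m then 1 else 0 else 0) -
          (if j = k then if l = m then if j = l then 1 else 0 else 0 else 0)) := by
  have hI : (Complex.I) ≠ 1 := by simp [Complex.ext_iff]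
  have hJ : (conj Complex.I) ≠ 1 := by simp [Complex.ext_iff]
  have hII : Complex.I * Complex.I ≠ 1 := by rw [Complex.I_mul_I]; norm_num
  by_cases hjk : j = k
  · subst hjk
    by_cases hlm : l = m
    · subst hlm
      have : ∀ z : ι → Fin 4, phase (z j) * conj (phase (z j)) *
          (conj (phase (z l)) * phase (z l)) = 1 := fun z => by
        rw [phase_mul_conj, mul_comm (conj _), phase_mul_conj, one_mul]
      simp only [this]
      by_cases hjl : j = l <;> simp [hjl]
    · have : ∑ z : ι → Fin 4, phase (z j) * conj (phase (z j)) *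
          (conj (phase (z l)) * phase (z m)) = 0 := by
        refine sum_eq_zero_of_shift _ m Complex.I hI fun z => ?_
        simp only [phase_mul_conj]
        simp only [phase_add_single, hlm]
        simp; ring
      rw [this]
      by_cases hjl : j = l
      · subst hjl; simp [hlm]
      · simp [hlm, hjl]
  · by_cases hjl : j = l
    · subst hjl
      by_cases hkm : k = m
      · subst hkm
        have : ∀ z : ι → Fin 4, phase (z j) * conj (phase (z k)) *
            (conj (phase (z j)) * phase (z k)) = 1 := fun z => by
          linear_combination (conj (phase (z k)) * phase (z k)) * phase_mul_conj (z j) +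
            phase_mul_conj (z k)
        simp only [this]
        simp [hjk]
      · have : ∑ z : ι → Fin 4, phase (z j) * conj (phase (z k)) *
            (conj (phase (z j)) * phase (z m)) = 0 := by
          refine sum_eq_zero_of_shift _ k (conj Complex.I) hJ fun z => ?_
          simp only [phase_add_single, hjk, Ne.symm hkm]
          simp; ring
        rw [this]; simp [hjk, hkm]
    · have : ∑ z : ι → Fin 4, phase (z j) * conj (phase (z k)) *
            (conj (phase (z l)) * phase (z m)) = 0 := by
        by_cases hjm : m = j
        · subst hjm
          refine sum_eq_zero_of_shift _ m (Complex.I * Complex.I) hII fun z => ?_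
          simp only [phase_add_single, Ne.symm hjk, Ne.symm hjl]
          simp; ring_nf; simp
        · refine sum_eq_zero_of_shift _ j Complex.I hI fun z => ?_
          simp only [phase_add_single, Ne.symm hjk, Ne.symm hjl, hjm]
          simp; ring
      rw [this]; simp [hjk, hjl]

theorem norm_sq_eq_mul_conj (z : ℂ) : ((‖z‖ ^ 2 : ℝ) : ℂ) = z * conj z := by
  rw [Complex.mul_conj']; norm_cast

/-- The second moment of a sesquilinear expression in independent random phases. -/
theorem sum_phase_second_moment (x : ι → ι → ℂ) :
    ∑ z : ι → Fin 4, ‖∑ j, ∑ k, phase (z j) * conj (phase (z k)) * x j k‖ ^ 2 =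
      (Fintype.card (ι → Fin 4) : ℝ) *
        (‖∑ j, x j j‖ ^ 2 + ∑ j, ∑ k, ‖x j k‖ ^ 2 - ∑ j, ‖x j j‖ ^ 2) := by
  apply Complex.ofReal_injective
  push_cast
  simp only [← Complex.ofReal_pow, norm_sq_eq_mul_conj, map_sum, map_mul, Complex.conj_conj]
  have key : ∀ z : ι → Fin 4,
      (∑ j, ∑ k, phase (z j) * conj (phase (z k)) * x j k) *
        (∑ j, ∑ k, conj (phase (z j)) * phase (z k) * conj (x j k)) =
      ∑ p : ι × ι, ∑ q : ι × ι, (phase (z p.1) * conj (phase (z p.2)) *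
        (conj (phase (z q.1)) * phase (z q.2))) * (x p.1 p.2 * conj (x q.1 q.2)) := fun z => by
    rw [← Fintype.sum_prod_type', ← Fintype.sum_prod_type', Finset.sum_mul_sum]
    refine Finset.sum_congr rfl fun p _ => Finset.sum_congr rfl fun q _ => ?_
    ring
  simp only [key]
  rw [Finset.sum_comm]
  simp_rw [Finset.sum_comm (s := (Finset.univ : Finset (ι → Fin 4))), ← Finset.sum_mul,
    sum_phase_moment]
  simp only [mul_assoc, ← Finset.mul_sum]
  congr 1
  simp only [Fintype.sum_prod_type, add_mul, sub_mul, Finset.sum_add_distrib,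
    Finset.sum_sub_distrib, ite_mul, one_mul, zero_mul, Finset.sum_ite_irrel,
    Finset.sum_const_zero, Finset.sum_ite_eq, Finset.mem_univ, if_true, Finset.sum_mul_sum]

/-- The symmetric group is 2-transitive: `τ * σ` carries `(a, b)` to `(a', b')`, and right
multiplication by it reindexes the sum. -/
theorem sum_perm_pair_eq (f : ι → ι → ℝ) {a b a' b' : ι} (h : a ≠ b) (h' : a' ≠ b') :
    ∑ π : Equiv.Perm ι, f (π a) (π b) = ∑ π : Equiv.Perm ι, f (π a') (π b') := by
  let σ : Equiv.Perm ι := Equiv.swap a a'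
  let τ : Equiv.Perm ι := Equiv.swap (σ b) b'
  have hσ : σ b ≠ a' := by
    intro e
    apply h
    have : σ a = a' := Equiv.swap_apply_left _ _
    exact σ.injective (this.trans e.symm)
  have ha : (τ * σ) a = a' := by
    have : σ a = a' := Equiv.swap_apply_left _ _
    rw [Equiv.Perm.mul_apply, this]
    exact Equiv.swap_apply_of_ne_of_ne hσ.symm h'
  have hb : (τ * σ) b = b' := by
    rw [Equiv.Perm.mul_apply]; exact Equiv.swap_apply_left _ _
  symm
  refine Fintype.sum_equiv (Equiv.mulRight (τ * σ)) _ _ fun π => ?_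
  simp only [Equiv.coe_mulRight, Equiv.Perm.mul_apply] at ha hb ⊢
  rw [ha, hb]

theorem sum_offDiag_const (c : ℝ) :
    ∑ i : ι, ∑ j, (if i = j then 0 else c) =
      (Fintype.card ι : ℝ) * ((Fintype.card ι : ℝ) - 1) * c := by
  have : ∀ i : ι, ∑ j, (if i = j then 0 else c) = ((Fintype.card ι : ℝ) - 1) * c := fun i => by
    have h : ∀ j : ι, (if i = j then 0 else c) = c - if i = j then c else 0 := fun j => by
      split_ifs <;> simp
    simp only [h, Finset.sum_sub_distrib, Finset.sum_const, Finset.sum_ite_eq, Finset.mem_univ,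
      if_true, Finset.card_univ, nsmul_eq_mul]
    ring
  simp only [this, Finset.sum_const, Finset.card_univ, nsmul_eq_mul]
  ring

theorem sum_perm_pair (f : ι → ι → ℝ) {a b : ι} (h : a ≠ b) :
    (Fintype.card ι : ℝ) * ((Fintype.card ι : ℝ) - 1) * ∑ π : Equiv.Perm ι, f (π a) (π b) =
      (Fintype.card (Equiv.Perm ι) : ℝ) * ∑ i, ∑ j, (if i = j then 0 else f i j) := by
  rw [← sum_offDiag_const]
  have h1 : ∀ i j : ι, (if i = j then 0 else ∑ π : Equiv.Perm ι, f (π a) (π b)) =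
      ∑ π : Equiv.Perm ι, (if i = j then 0 else f (π i) (π j)) := fun i j => by
    by_cases hij : i = j
    · simp [hij]
    · simp only [hij, if_false]
      exact sum_perm_pair_eq f h hij
  simp only [h1]
  simp_rw [Finset.sum_comm (t := (Finset.univ : Finset (Equiv.Perm ι)))]
  rw [← Finset.card_univ, ← nsmul_eq_mul, ← Finset.sum_const]
  refine Finset.sum_congr rfl fun π _ => ?_
  refine Fintype.sum_equiv π _ _ fun i => Fintype.sum_equiv π _ _ fun j => ?_
  simp

/-- The average of a weighted sum over pairs of distinct elements, under a random relabelling. -/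
theorem sum_perm_weighted (r f : ι → ι → ℝ) :
    (Fintype.card ι : ℝ) * ((Fintype.card ι : ℝ) - 1) *
        ∑ π : Equiv.Perm ι, ∑ i, ∑ j, (if i = j then 0 else r i j * f (π i) (π j)) =
      (Fintype.card (Equiv.Perm ι) : ℝ) * ((∑ i, ∑ j, (if i = j then 0 else r i j)) *
        ∑ i, ∑ j, (if i = j then 0 else f i j)) := by
  rw [Finset.sum_comm]
  simp_rw [Finset.sum_comm (s := (Finset.univ : Finset (Equiv.Perm ι)))]
  rw [Finset.sum_mul, Finset.mul_sum, Finset.mul_sum]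
  refine Finset.sum_congr rfl fun i _ => ?_
  rw [Finset.sum_mul, Finset.mul_sum, Finset.mul_sum]
  refine Finset.sum_congr rfl fun j _ => ?_
  by_cases hij : i = j
  · simp [hij]
  · simp only [hij, if_false, ← Finset.mul_sum]
    linear_combination r i j * sum_perm_pair f hij

/-- The diagonal unitary with given phases. -/
def phaseMatrix (z : ι → Fin 4) : Matrix ι ι ℂ := Matrix.diagonal fun i => phase (z i)

theorem phaseMatrix_mem (z : ι → Fin 4) : phaseMatrix z ∈ Matrix.unitaryGroup ι ℂ := by
  rw [Matrix.mem_unitaryGroup_iff, phaseMatrix, Matrix.star_eq_conjTranspose,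
    Matrix.diagonal_conjTranspose, Matrix.diagonal_mul_diagonal]
  simp [phase_mul_conj]

theorem phaseMatrix_conj_apply (z : ι → Fin 4) (m : Matrix ι ι ℂ) (i j : ι) :
    (phaseMatrix z * m * (phaseMatrix z)ᴴ) i j = phase (z i) * conj (phase (z j)) * m i j := by
  rw [phaseMatrix, Matrix.diagonal_conjTranspose, Matrix.mul_diagonal, Matrix.diagonal_mul]
  simp; ring

/-- The unitary permuting the standard basis. -/
def permMatrix (π : Equiv.Perm ι) : Matrix ι ι ℂ := (1 : Matrix ι ι ℂ).submatrix π id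

theorem permMatrix_conj (π : Equiv.Perm ι) (m : Matrix ι ι ℂ) :
    permMatrix π * m * (permMatrix π)ᴴ = m.submatrix π π := by
  ext i j
  simp [permMatrix, Matrix.mul_apply, Matrix.one_apply]

theorem permMatrix_mem (π : Equiv.Perm ι) : permMatrix π ∈ Matrix.unitaryGroup ι ℂ := by
  rw [Matrix.mem_unitaryGroup_iff, Matrix.star_eq_conjTranspose]
  have := permMatrix_conj π 1
  rw [mul_one] at this
  simp [this]

/-- There is a unitary all of whose entries have the same modulus (the discrete Fourier
transform). -/
theorem exists_flat_unitary (ι : Type*) [Fintype ι] [DecidableEq ι] [Nonempty ι] :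
    ∃ F ∈ Matrix.unitaryGroup ι ℂ, ∀ i j, F i j * conj (F i j) = 1 / (Fintype.card ι : ℂ) := by
  have : NeZero (Fintype.card ι) := ⟨Fintype.card_ne_zero⟩
  let e : ι ≃ ZMod (Fintype.card ι) := Fintype.equivOfCardEq (ZMod.card _).symm
  have hn : (0 : ℝ) < Fintype.card ι := by exact_mod_cast Fintype.card_pos
  have hs : (((√(Fintype.card ι : ℝ))⁻¹ : ℝ) : ℂ) * (((√(Fintype.card ι : ℝ))⁻¹ : ℝ) : ℂ) =
      1 / (Fintype.card ι : ℂ) := by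
    rw [← Complex.ofReal_mul, ← mul_inv, Real.mul_self_sqrt hn.le]
    push_cast; simp
  let F : Matrix ι ι ℂ := Matrix.of fun i j =>
    (((√(Fintype.card ι : ℝ))⁻¹ : ℝ) : ℂ) * ZMod.stdAddChar (e i * e j)
  have hF : ∀ i j k, F i j * conj (F k j) =
      1 / (Fintype.card ι : ℂ) * ZMod.stdAddChar (e j * (e i - e k)) := fun i j k => by
    simp only [F, Matrix.of_apply, map_mul, Complex.conj_ofReal, ← AddChar.map_neg_eq_conj]
    rw [← hs, mul_sub, sub_eq_add_neg, AddChar.map_add_eq_mul, mul_comm (e j), mul_comm (e j)]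
    ring
  refine ⟨F, ?_, fun i j => ?_⟩
  · rw [Matrix.mem_unitaryGroup_iff]
    ext i k
    rw [Matrix.mul_apply]
    simp only [Matrix.star_apply]
    have : ∑ j, F i j * star (F k j) =
        ∑ j, 1 / (Fintype.card ι : ℂ) * ZMod.stdAddChar (j * (e i - e k)) :=
      Fintype.sum_equiv e _ _ fun j => hF i j k
    -- Unitarity is the orthogonality of the additive characters of `ZMod n`.
    rw [this, ← Finset.mul_sum, AddChar.sum_mulShift _ (ZMod.isPrimitive_stdAddChar _)]
    have hn' : (Fintype.card ι : ℂ) ≠ 0 := by exact_mod_cast hn.ne'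
    by_cases h : i = k
    · subst h; simp
    · simp [h, sub_eq_zero]
  · rw [hF]; simp

end Twirl

/-! ### The Hilbert–Schmidt norm and its unitary invariance. -/

section Frobenius

variable {m n : Type*} [Fintype m] [Fintype n]

/-- The square of the Hilbert--Schmidt norm. -/
def frobSq (M : Matrix m n ℂ) : ℝ := ∑ i, ∑ j, ‖M i j‖ ^ 2

theorem frobSq_nonneg (M : Matrix m n ℂ) : 0 ≤ frobSq M :=
  Finset.sum_nonneg fun _ _ => Finset.sum_nonneg fun _ _ => by positivity

theorem ofReal_frobSq (M : Matrix m n ℂ) : (frobSq M : ℂ) = (M * Mᴴ).trace := by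
  simp only [frobSq, Matrix.trace, Matrix.diag, Matrix.mul_apply, Matrix.conjTranspose_apply]
  push_cast
  refine Finset.sum_congr rfl fun i _ => Finset.sum_congr rfl fun j _ => ?_
  rw [← Complex.ofReal_pow, norm_sq_eq_mul_conj]; rfl

theorem frobSq_conj [DecidableEq m] {U : Matrix m m ℂ} (hU : U ∈ Matrix.unitaryGroup m ℂ)
    (M : Matrix m m ℂ) : frobSq (U * M * Uᴴ) = frobSq M := by
  apply Complex.ofReal_injective
  have h : Uᴴ * U = 1 := Matrix.mem_unitaryGroup_iff'.1 hU
  rw [ofReal_frobSq, ofReal_frobSq]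
  simp only [Matrix.conjTranspose_mul, Matrix.conjTranspose_conjTranspose]
  rw [show U * M * Uᴴ * (U * (Mᴴ * Uᴴ)) = U * M * (Uᴴ * U) * (Mᴴ * Uᴴ) by
    simp only [Matrix.mul_assoc], h, Matrix.mul_one, ← Matrix.mul_assoc, Matrix.trace_mul_comm,
    ← Matrix.mul_assoc, ← Matrix.mul_assoc, h, Matrix.one_mul]

theorem trace_conj [DecidableEq m] {U : Matrix m m ℂ} (hU : U ∈ Matrix.unitaryGroup m ℂ)
    (M : Matrix m m ℂ) : (U * M * Uᴴ).trace = M.trace := by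
  have h : Uᴴ * U = 1 := Matrix.mem_unitaryGroup_iff'.1 hU
  rw [Matrix.trace_mul_comm, ← Matrix.mul_assoc, h, Matrix.one_mul]

end Frobenius

/-! ### Decoupling: partial traces after a random unitary. -/

section Twirl

variable {K T : Type*} [Fintype K] [DecidableEq K] [Fintype T] [DecidableEq T]

theorem norm_sq_sum {ι : Type*} [Fintype ι] (a : ι → ℂ) :
    ‖∑ i, a i‖ ^ 2 = ∑ i, ∑ j, (a i * conj (a j)).re := by
  apply Complex.ofReal_injective
  have h : ((∑ i, ∑ j, (a i * conj (a j)).re : ℝ)) = (∑ i, ∑ j, a i * conj (a j)).re := by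
    simp only [Complex.re_sum]
  rw [h, ← Finset.sum_mul_sum, ← map_sum, ← norm_sq_eq_mul_conj, Complex.ofReal_re]

/-- The purity-like functional `‖tr_T m‖₂²`. -/
def marginalSq (m : Matrix (K × T) (K × T) ℂ) : ℝ :=
  ∑ k, ∑ k', ‖∑ t, m (k, t) (k', t)‖ ^ 2

/-- The average of `‖tr_T m‖₂²` over conjugations by diagonal phases. -/
def phaseAverage (m : Matrix (K × T) (K × T) ℂ) : ℝ :=
  (∑ i, ∑ j, if i = j then 0 else (if i.1 = j.1 then 1 else 0) * (m i i * conj (m j j)).re) +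
    (∑ i, ∑ j, if i = j then 0 else (if i.2 = j.2 then 1 else 0) * ‖m i j‖ ^ 2) +
    ∑ i, ‖m i i‖ ^ 2

theorem sum_offDiag_add_diag {ι : Type*} [Fintype ι] [DecidableEq ι] (f : ι → ι → ℝ) :
    ∑ i, ∑ j, f i j = (∑ i, ∑ j, if i = j then 0 else f i j) + ∑ i, f i i := by
  rw [← Finset.sum_add_distrib]
  refine Finset.sum_congr rfl fun i _ => ?_
  have : ∀ j, f i j = (if i = j then 0 else f i j) + if i = j then f i j else 0 := fun j => by
    split_ifs <;> simp
  rw [Finset.sum_congr rfl fun j _ => this j, Finset.sum_add_distrib]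
  simp

/-- Each entry of the partial trace is a sesquilinear form in the phases, so
`sum_phase_second_moment` applies entrywise. The diagonal weight `∑ ‖m i i‖²` arises twice with a
plus sign and once with a minus sign, hence once in `phaseAverage`. -/
theorem sum_marginalSq_phase (m : Matrix (K × T) (K × T) ℂ) :
    ∑ z, marginalSq (phaseMatrix z * m * (phaseMatrix z)ᴴ) =
      (Fintype.card (K × T → Fin 4) : ℝ) * phaseAverage m := by
  -- Only the coefficients of `m` that contribute to the `(k, k')` entry of the partial trace are
  -- kept.
  let x : K → K → K × T → K × T → ℂ := fun k k' i j =>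
    if i.1 = k then if j.1 = k' then if i.2 = j.2 then m i j else 0 else 0 else 0
  have h1 : ∀ (z : K × T → Fin 4) k k',
      ∑ t, (phaseMatrix z * m * (phaseMatrix z)ᴴ) (k, t) (k', t) =
        ∑ i, ∑ j, phase (z i) * conj (phase (z j)) * x k k' i j := fun z k k' => by
    simp [x, phaseMatrix_conj_apply, Fintype.sum_prod_type]
  simp only [marginalSq, h1]
  rw [Finset.sum_comm]
  simp_rw [Finset.sum_comm (s := (Finset.univ : Finset (K × T → Fin 4))), sum_phase_second_moment]
  simp only [← Finset.mul_sum]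
  congr 1
  simp only [Finset.sum_add_distrib, Finset.sum_sub_distrib]
  have e1 : ∑ k, ∑ k', ‖∑ j, x k k' j j‖ ^ 2 =
      (∑ i, ∑ j, if i = j then 0 else
        (if i.1 = j.1 then 1 else 0) * (m i i * conj (m j j)).re) + ∑ i, ‖m i i‖ ^ 2 := by
    have h : ∀ i j, ∑ k, ∑ k', (x k k' i i * conj (x k k' j j)).re =
        (if i.1 = j.1 then 1 else 0) * (m i i * conj (m j j)).re := fun i j => by
      by_cases hij : i.1 = j.1
      · simp only [x, hij, if_true, one_mul]
        rw [Finset.sum_eq_single j.1, Finset.sum_eq_single j.1] <;> simp +contextual [eq_comm]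
      · rw [if_neg hij, zero_mul]
        refine Finset.sum_eq_zero fun k _ => Finset.sum_eq_zero fun k' _ => ?_
        by_cases hk : i.1 = k
        · have : j.1 ≠ k := fun h => hij (hk.trans h.symm)
          simp [x, this]
        · simp [x, hk]
    have h' : ∀ i, (if i.1 = i.1 then (1 : ℝ) else 0) * (m i i * conj (m i i)).re =
        ‖m i i‖ ^ 2 := fun i => by
      rw [← norm_sq_eq_mul_conj, Complex.ofReal_re]; simp
    rw [← Finset.sum_congr rfl fun i _ => h' i, ← sum_offDiag_add_diag fun i j : K × T =>
      (if i.1 = j.1 then (1 : ℝ) else 0) * (m i i * conj (m j j)).re]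
    simp only [← h, norm_sq_sum]
    rw [Finset.sum_congr rfl fun k _ => Finset.sum_comm, Finset.sum_comm]
    refine Finset.sum_congr rfl fun i _ => ?_
    rw [Finset.sum_congr rfl fun k _ => Finset.sum_comm, Finset.sum_comm]
  have e2 : ∑ k, ∑ k', ∑ i, ∑ j, ‖x k k' i j‖ ^ 2 =
      (∑ i, ∑ j, if i = j then 0 else (if i.2 = j.2 then 1 else 0) * ‖m i j‖ ^ 2) +
        ∑ i, ‖m i i‖ ^ 2 := by
    have h : ∀ i j, ∑ k, ∑ k', ‖x k k' i j‖ ^ 2 =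
        (if i.2 = j.2 then 1 else 0) * ‖m i j‖ ^ 2 := fun i j => by
      simp only [x, apply_ite norm, norm_zero, ite_pow]
      simp
    have h' : ∀ i, (if i.2 = i.2 then (1 : ℝ) else 0) * ‖m i i‖ ^ 2 =
        ‖m i i‖ ^ 2 := fun i => by simp
    rw [← Finset.sum_congr rfl fun i _ => h' i, ← sum_offDiag_add_diag fun i j : K × T =>
      (if i.2 = j.2 then (1 : ℝ) else 0) * ‖m i j‖ ^ 2]
    simp only [← h]
    rw [Finset.sum_congr rfl fun k _ => Finset.sum_comm, Finset.sum_comm]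
    refine Finset.sum_congr rfl fun i _ => ?_
    rw [Finset.sum_congr rfl fun k _ => Finset.sum_congr rfl fun k' _ => rfl]
    simp_rw [Finset.sum_comm (t := (Finset.univ : Finset (K × T)))]
  have e3 : ∑ k, ∑ k', ∑ i, ‖x k k' i i‖ ^ 2 = ∑ i, ‖m i i‖ ^ 2 := by
    have h : ∀ i, ∑ k, ∑ k', ‖x k k' i i‖ ^ 2 = ‖m i i‖ ^ 2 := fun i => by
      simp only [x, apply_ite norm, norm_zero, ite_pow]
      simp
    rw [Finset.sum_congr rfl fun k _ => Finset.sum_comm, Finset.sum_comm]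
    exact Finset.sum_congr rfl fun i _ => h i
  rw [e1, e2, e3, phaseAverage]
  ring

theorem sum_sameFst :
    (∑ i : K × T, ∑ j : K × T, if i = j then 0 else if i.1 = j.1 then (1 : ℝ) else 0) =
      (Fintype.card K : ℝ) * Fintype.card T * (Fintype.card T - 1) := by
  have h := sum_offDiag_add_diag fun i j : K × T => if i.1 = j.1 then (1 : ℝ) else 0
  have h' : (∑ i : K × T, ∑ j : K × T, if i.1 = j.1 then (1 : ℝ) else 0) =
      (Fintype.card K : ℝ) * Fintype.card T * Fintype.card T := by
    have hi : ∀ i : K × T, (∑ j : K × T, if i.1 = j.1 then (1 : ℝ) else 0) = Fintype.card T := by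
      intro i
      rw [Fintype.sum_prod_type]
      change ∑ k, ∑ _t : T, (if i.1 = k then (1 : ℝ) else 0) = _
      simp
    simp only [hi, Finset.sum_const, Finset.card_univ, nsmul_eq_mul, Fintype.card_prod,
      Nat.cast_mul]
  rw [h'] at h
  simp only [if_true, Finset.sum_const, Finset.card_univ, nsmul_eq_mul, Fintype.card_prod,
    Nat.cast_mul] at h
  linarith

theorem sum_sameSnd :
    (∑ i : K × T, ∑ j : K × T, if i = j then 0 else if i.2 = j.2 then (1 : ℝ) else 0) =
      (Fintype.card K : ℝ) * Fintype.card T * (Fintype.card K - 1) := by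
  have h := sum_offDiag_add_diag fun i j : K × T => if i.2 = j.2 then (1 : ℝ) else 0
  have h' : (∑ i : K × T, ∑ j : K × T, if i.2 = j.2 then (1 : ℝ) else 0) =
      (Fintype.card K : ℝ) * Fintype.card T * Fintype.card K := by
    have hi : ∀ i : K × T, (∑ j : K × T, if i.2 = j.2 then (1 : ℝ) else 0) = Fintype.card K := by
      intro i
      rw [Fintype.sum_prod_type]
      change ∑ _k : K, ∑ t, (if i.2 = t then (1 : ℝ) else 0) = _
      simp
    simp only [hi, Finset.sum_const, Finset.card_univ, nsmul_eq_mul, Fintype.card_prod,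
      Nat.cast_mul]
  rw [h'] at h
  simp only [if_true, Finset.sum_const, Finset.card_univ, nsmul_eq_mul, Fintype.card_prod,
    Nat.cast_mul] at h
  linarith

/-- Permutations spread the off-diagonal sums evenly over all pairs, leaving the trace, the
Hilbert–Schmidt norm and the diagonal weight. Only the last is not unitarily invariant;
`sum_diag_flat` takes care of it. -/
theorem sum_perm_phaseAverage (m : Matrix (K × T) (K × T) ℂ) :
    (Fintype.card (K × T) : ℝ) * ((Fintype.card (K × T) : ℝ) - 1) *
        ∑ π : Equiv.Perm (K × T), phaseAverage (permMatrix π * m * (permMatrix π)ᴴ) =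
      (Fintype.card (Equiv.Perm (K × T)) : ℝ) * (Fintype.card K * Fintype.card T) *
        ((Fintype.card T - 1) * ‖m.trace‖ ^ 2 + (Fintype.card K - 1) * frobSq m +
          (Fintype.card K - 1) * (Fintype.card T - 1) * ∑ i, ‖m i i‖ ^ 2) := by
  have hA := sum_perm_weighted (fun i j : K × T => if i.1 = j.1 then 1 else 0)
    fun i j => (m i i * conj (m j j)).re
  have hB := sum_perm_weighted (fun i j : K × T => if i.2 = j.2 then 1 else 0)
    fun i j => ‖m i j‖ ^ 2
  have hC : ∑ π : Equiv.Perm (K × T), ∑ i, ‖m (π i) (π i)‖ ^ 2 =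
      (Fintype.card (Equiv.Perm (K × T)) : ℝ) * ∑ i, ‖m i i‖ ^ 2 := by
    rw [← Finset.card_univ, ← nsmul_eq_mul, ← Finset.sum_const]
    exact Finset.sum_congr rfl fun π _ => Fintype.sum_equiv π _ _ fun i => rfl
  rw [sum_sameFst] at hA
  rw [sum_sameSnd] at hB
  have hA' : ∑ i, ∑ j, (if i = j then 0 else (m i i * conj (m j j)).re) =
      ‖m.trace‖ ^ 2 - ∑ i, ‖m i i‖ ^ 2 := by
    have := sum_offDiag_add_diag fun i j => (m i i * conj (m j j)).re
    rw [← norm_sq_sum] at this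
    simp only [← norm_sq_eq_mul_conj, Complex.ofReal_re] at this
    simp only [Matrix.trace, Matrix.diag]
    linarith
  have hB' : ∑ i, ∑ j, (if i = j then 0 else ‖m i j‖ ^ 2) = frobSq m - ∑ i, ‖m i i‖ ^ 2 := by
    have := sum_offDiag_add_diag fun i j => ‖m i j‖ ^ 2
    rw [frobSq]
    linarith
  rw [hA'] at hA
  rw [hB'] at hB
  simp only [permMatrix_conj, phaseAverage, Matrix.submatrix_apply, Finset.sum_add_distrib,
    mul_add, hC]
  rw [hA, hB]
  rw [Fintype.card_prod]
  push_cast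
  ring

/-- Conjugation by a flat unitary turns each diagonal entry into a form in the phases whose
coefficients are entries of `m` times factors of modulus `1 / |ι|`. The second moment then spreads
the weight evenly over the diagonal; its negative term is dropped. -/
theorem sum_diag_flat {ι : Type*} [Fintype ι] [DecidableEq ι] [Nonempty ι] {F : Matrix ι ι ℂ}
    (hF : ∀ i j, F i j * conj (F i j) = 1 / (Fintype.card ι : ℂ)) (m : Matrix ι ι ℂ) :
    ∑ z : ι → Fin 4, ∑ a,
        ‖((F * (phaseMatrix z * m * (phaseMatrix z)ᴴ) * Fᴴ : Matrix ι ι ℂ)) a a‖ ^ 2 ≤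
      (Fintype.card (ι → Fin 4) : ℝ) * ((‖m.trace‖ ^ 2 + frobSq m) / Fintype.card ι) := by
  have hn : (0 : ℝ) < Fintype.card ι := by exact_mod_cast Fintype.card_pos
  have hF' : ∀ i j, ‖F i j‖ ^ 2 = 1 / (Fintype.card ι : ℝ) := fun i j => by
    apply Complex.ofReal_injective
    rw [norm_sq_eq_mul_conj, hF]; push_cast; rfl
  have h1 : ∀ (z : ι → Fin 4) a,
      ((F * (phaseMatrix z * m * (phaseMatrix z)ᴴ) * Fᴴ : Matrix ι ι ℂ)) a a =
      ∑ j, ∑ k, phase (z j) * conj (phase (z k)) * (F a j * conj (F a k) * m j k) := fun z a => by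
    simp only [Matrix.mul_apply (M := F * _), Matrix.mul_apply (M := F), Finset.sum_mul,
      phaseMatrix_conj_apply, Matrix.conjTranspose_apply]
    rw [Finset.sum_comm]
    refine Finset.sum_congr rfl fun j _ => Finset.sum_congr rfl fun k _ => ?_
    rw [starRingEnd_apply (F a k)]; ring
  simp only [h1]
  rw [Finset.sum_comm]
  simp only [sum_phase_second_moment, ← Finset.mul_sum]
  refine mul_le_mul_of_nonneg_left ?_ (by positivity)
  have h2 : ∀ a : ι, ‖∑ j, F a j * conj (F a j) * m j j‖ ^ 2 +
      ∑ j, ∑ k, ‖F a j * conj (F a k) * m j k‖ ^ 2 - ∑ j, ‖F a j * conj (F a j) * m j j‖ ^ 2 ≤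
      (‖m.trace‖ ^ 2 + frobSq m) / (Fintype.card ι : ℝ) ^ 2 := fun a => by
    have e1 : ‖∑ j, F a j * conj (F a j) * m j j‖ ^ 2 =
        ‖m.trace‖ ^ 2 / (Fintype.card ι : ℝ) ^ 2 := by
      simp only [hF, ← Finset.mul_sum]
      rw [norm_mul, mul_pow, Matrix.trace]
      simp [Matrix.diag, div_eq_inv_mul]
    have e2 : ∑ j, ∑ k, ‖F a j * conj (F a k) * m j k‖ ^ 2 =
        frobSq m / (Fintype.card ι : ℝ) ^ 2 := by
      simp only [norm_mul, mul_pow, RCLike.norm_conj, hF', ← Finset.mul_sum, frobSq]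
      field_simp
    have e3 : 0 ≤ ∑ j, ‖F a j * conj (F a j) * m j j‖ ^ 2 :=
      Finset.sum_nonneg fun _ _ => by positivity
    rw [e1, e2, add_div]; linarith
  refine (Finset.sum_le_sum fun a _ => h2 a).trans (le_of_eq ?_)
  rw [Finset.sum_const, Finset.card_univ, nsmul_eq_mul]
  field_simp

/-- Decoupling by a random unitary: for a suitable unitary, the total Hilbert--Schmidt weight of
the partial traces over `T` is at most its value for a Haar-random unitary. -/
theorem exists_unitary_marginalSq_le {Γ : Type*} [Fintype Γ] [Nonempty K] [Nonempty T]
    (m : Γ → Matrix (K × T) (K × T) ℂ) :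
    ∃ U ∈ Matrix.unitaryGroup (K × T) ℂ, ∑ c, marginalSq (U * m c * Uᴴ) ≤
      ∑ c, (‖(m c).trace‖ ^ 2 / Fintype.card K + frobSq (m c) / Fintype.card T) := by
  obtain ⟨F, hFU, hF⟩ := exists_flat_unitary (K × T)
  -- Dimension one is separate because the averaging identity is divided by `|K||T| (|K||T| - 1)`
  -- below.
  by_cases hd : Fintype.card (K × T) = 1
  · have hK : Fintype.card K = 1 := by
      rw [Fintype.card_prod] at hd; exact Nat.eq_one_of_mul_eq_one_right hd
    have hT : Fintype.card T = 1 := by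
      rw [Fintype.card_prod] at hd; exact Nat.eq_one_of_mul_eq_one_left hd
    obtain ⟨k₀, hk⟩ := Fintype.card_eq_one_iff.1 hK
    obtain ⟨t₀, ht⟩ := Fintype.card_eq_one_iff.1 hT
    let : Unique K := ⟨⟨k₀⟩, hk⟩
    let : Unique T := ⟨⟨t₀⟩, ht⟩
    refine ⟨1, one_mem _, Finset.sum_le_sum fun c _ => ?_⟩
    simp [marginalSq, Matrix.trace, frobSq, Fintype.sum_prod_type]
  have hK : (1 : ℝ) ≤ Fintype.card K := by exact_mod_cast Fintype.card_pos
  have hT : (1 : ℝ) ≤ Fintype.card T := by exact_mod_cast Fintype.card_pos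
  have hd' : (1 : ℝ) < Fintype.card K * Fintype.card T := by
    have : 0 < Fintype.card (K × T) := Fintype.card_pos
    have h2 : 1 < Fintype.card (K × T) := by omega
    rw [Fintype.card_prod] at h2
    exact_mod_cast h2
  -- Read from the right: phases and `F` flatten the diagonal, the permutation symmetrizes pairs of
  -- indices, and the last phases remove the cross terms in the partial trace.
  let V : (K × T → Fin 4) × Equiv.Perm (K × T) × (K × T → Fin 4) → Matrix (K × T) (K × T) ℂ :=
    fun ω => phaseMatrix ω.2.2 * (permMatrix ω.2.1 * (F * phaseMatrix ω.1))
  have hV : ∀ ω, V ω ∈ Matrix.unitaryGroup (K × T) ℂ := fun ω =>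
    mul_mem (phaseMatrix_mem _) (mul_mem (permMatrix_mem _) (mul_mem hFU (phaseMatrix_mem _)))
  have avg : ∀ M : Matrix (K × T) (K × T) ℂ, ∑ ω, marginalSq (V ω * M * (V ω)ᴴ) ≤
      ∑ ω : (K × T → Fin 4) × Equiv.Perm (K × T) × (K × T → Fin 4),
        (‖M.trace‖ ^ 2 / Fintype.card K + frobSq M / Fintype.card T) := fun M => by
    have hconj : ∀ ω, V ω * M * (V ω)ᴴ = phaseMatrix ω.2.2 * (permMatrix ω.2.1 *
        (F * (phaseMatrix ω.1 * M * (phaseMatrix ω.1)ᴴ) * Fᴴ) * (permMatrix ω.2.1)ᴴ) *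
          (phaseMatrix ω.2.2)ᴴ := fun ω => by
      simp only [V, Matrix.conjTranspose_mul, Matrix.mul_assoc]
    have hz : ∀ z, _ := fun z : K × T → Fin 4 =>
      sum_perm_phaseAverage (F * (phaseMatrix z * M * (phaseMatrix z)ᴴ) * Fᴴ)
    simp only [trace_conj hFU, frobSq_conj hFU, trace_conj (phaseMatrix_mem _),
      frobSq_conj (phaseMatrix_mem _)] at hz
    have hq := sum_diag_flat hF M
    simp only [Fintype.sum_prod_type (α₁ := K × T → Fin 4), hconj,
      Fintype.sum_prod_type (α₁ := Equiv.Perm (K × T)), sum_marginalSq_phase]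
    simp only [← Finset.mul_sum, Finset.sum_const, Finset.card_univ, nsmul_eq_mul]
    have hz' := Finset.sum_congr (rfl : (Finset.univ : Finset (K × T → Fin 4)) = Finset.univ)
      fun z _ => hz z
    simp only [← Finset.mul_sum, Finset.sum_add_distrib, Finset.sum_const, Finset.card_univ,
      nsmul_eq_mul] at hz'
    rw [Fintype.card_prod K T] at hz' hq
    push_cast at hz' hq
    set k : ℝ := (Fintype.card K : ℝ)
    set t : ℝ := (Fintype.card T : ℝ)
    set n : ℝ := (Fintype.card (K × T → Fin 4) : ℝ)
    set p : ℝ := (Fintype.card (Equiv.Perm (K × T)) : ℝ)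
    set S := ∑ z : K × T → Fin 4, ∑ π : Equiv.Perm (K × T), phaseAverage (permMatrix π *
        (F * (phaseMatrix z * M * (phaseMatrix z)ᴴ) * Fᴴ) * (permMatrix π)ᴴ)
    set a := ‖M.trace‖ ^ 2
    set b := frobSq M
    set Q := ∑ z : K × T → Fin 4, ∑ i,
      ‖((F * (phaseMatrix z * M * (phaseMatrix z)ᴴ) * Fᴴ : Matrix (K × T) (K × T) ℂ)) i i‖ ^ 2
    have hk : 0 < k := by linarith
    have ht : 0 < t := by linarith
    have hn : 0 ≤ n := Nat.cast_nonneg _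
    have hp : 0 ≤ p := Nat.cast_nonneg _
    have ha : 0 ≤ a := by positivity
    have hb : 0 ≤ b := frobSq_nonneg M
    refine mul_le_mul_of_nonneg_left ?_ hn
    have hkt : 0 < k * t := by positivity
    have hpos : 0 < k * t * (k * t - 1) := mul_pos hkt (by linarith)
    refine le_of_mul_le_mul_left (hz'.trans_le ?_) hpos
    have h1 : (k - 1) * (t - 1) * Q ≤ (k - 1) * (t - 1) * (n * ((a + b) / (k * t))) :=
      mul_le_mul_of_nonneg_left hq (mul_nonneg (by linarith) (by linarith))
    have h2 : k * t * ((t - 1) * (n * a) + (k - 1) * (n * b) + (k - 1) * (t - 1) * Q) ≤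
        k * t * (k * t - 1) * (n * (a / k + b / t)) := by
      calc _ ≤ k * t * ((t - 1) * (n * a) + (k - 1) * (n * b) +
              (k - 1) * (t - 1) * (n * ((a + b) / (k * t)))) :=
            mul_le_mul_of_nonneg_left (by linarith) hkt.le
        _ = n * ((k * t ^ 2 - k - t + 1) * a + (t * k ^ 2 - k - t + 1) * b) := by
            field_simp; ring
        -- Here `1 ≤ k` and `1 ≤ t` suffice; the right side factors as `(k t - 1)(t a + k b)`.
        _ ≤ n * ((k * t ^ 2 - t) * a + (t * k ^ 2 - k) * b) := by
            refine mul_le_mul_of_nonneg_left (add_le_add ?_ ?_) hn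
            · exact mul_le_mul_of_nonneg_right (by linarith) ha
            · exact mul_le_mul_of_nonneg_right (by linarith) hb
        _ = _ := by field_simp
    calc _ = p * (k * t * ((t - 1) * (n * a) + (k - 1) * (n * b) + (k - 1) * (t - 1) * Q)) := by
          ring
      _ ≤ p * _ := mul_le_mul_of_nonneg_left h2 hp
      _ = _ := by ring
  obtain ⟨ω, -, hω⟩ := Finset.exists_le_of_sum_le (s := Finset.univ)
    (f := fun ω => ∑ c, marginalSq (V ω * m c * (V ω)ᴴ))
    (g := fun _ => ∑ c, (‖(m c).trace‖ ^ 2 / Fintype.card K + frobSq (m c) / Fintype.card T))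
    Finset.univ_nonempty (by
      rw [Finset.sum_comm, Finset.sum_comm (s := (Finset.univ : Finset (_ × _ × _)))]
      exact Finset.sum_le_sum fun c _ => avg (m c))
  exact ⟨V ω, hV ω, hω⟩

end Twirl

/-! ### Powers–Størmer and a form of Uhlmann's theorem. -/

section Uhlmann

open scoped ComplexOrder

theorem sum_norm_diag_le {n : Type*} [Fintype n] (M : Matrix n n ℂ) :
    ∑ i, ‖M i i‖ ≤ √(Fintype.card n * frobSq M) := by
  apply Real.le_sqrt_of_sq_le
  have h1 : (∑ i, ‖M i i‖) ^ 2 ≤ (Fintype.card n : ℝ) * ∑ i, ‖M i i‖ ^ 2 := by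
    simpa using sq_sum_le_card_mul_sum_sq (s := (Finset.univ : Finset n)) (f := fun i => ‖M i i‖)
  refine h1.trans (mul_le_mul_of_nonneg_left (Finset.sum_le_sum fun i _ => ?_) (by positivity))
  exact Finset.single_le_sum (f := fun j => ‖M i j‖ ^ 2) (fun _ _ => by positivity)
    (Finset.mem_univ i)

theorem frobSq_sub_of_hermitian {n : Type*} [Fintype n] {A B : Matrix n n ℂ} (hA : Aᴴ = A) (hB : Bᴴ = B) :
    frobSq (A - B) = (A * A).trace.re + (B * B).trace.re - 2 * (A * B).trace.re := by
  have h : frobSq (A - B) = (frobSq (A - B) : ℂ).re := rfl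
  rw [h, ofReal_frobSq, Matrix.conjTranspose_sub, hA, hB]
  simp only [mul_sub, sub_mul, Matrix.trace_sub, Complex.sub_re, Matrix.trace_mul_comm B A]
  ring

variable {n m l : Type*} [Fintype n] [DecidableEq n] [Fintype m] [DecidableEq m] [Fintype l]

/-- The Powers--Størmer inequality, with the trace norm bounded by the Hilbert--Schmidt norm. -/
theorem frobSq_sub_le {A B : Matrix n n ℂ} (hA : A.PosSemidef) (hB : B.PosSemidef) :
    frobSq (A - B) ≤ √(Fintype.card n * frobSq (A * A - B * B)) := by
  have hΔ : (A - B).IsHermitian := hA.1.sub hB.1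
  -- In an eigenbasis of `A - B`, the diagonal of `A² - B²` has entries `δ i * (A' i i + B' i i)`,
  -- and positivity gives `|δ i| ≤ A' i i + B' i i`. So `∑ δ i ^ 2` is at most the sum of the moduli
  -- of these entries.
  let U : Matrix n n ℂ := hΔ.eigenvectorUnitary
  have hU : U ∈ Matrix.unitaryGroup n ℂ := hΔ.eigenvectorUnitary.2
  have hU' : Uᴴ ∈ Matrix.unitaryGroup n ℂ := Unitary.star_mem hU
  have hUU : U * Uᴴ = 1 := Matrix.mem_unitaryGroup_iff.1 hU
  have hUU' : Uᴴ * U = 1 := Matrix.mem_unitaryGroup_iff'.1 hU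
  let A' := Uᴴ * A * U
  let B' := Uᴴ * B * U
  have hA' : A'.PosSemidef := hA.conjTranspose_mul_mul_same U
  have hB' : B'.PosSemidef := hB.conjTranspose_mul_mul_same U
  let δ := hΔ.eigenvalues
  have hD : A' - B' = Matrix.diagonal fun i => (δ i : ℂ) := by
    have h := hΔ.spectral_theorem
    rw [Unitary.conjStarAlgAut_apply] at h
    calc A' - B' = Uᴴ * (A - B) * U := by simp only [A', B', mul_sub, sub_mul]
      _ = Uᴴ * (U * Matrix.diagonal (RCLike.ofReal ∘ hΔ.eigenvalues) * Uᴴ) * U :=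
        congrArg (fun Z => Uᴴ * Z * U) h
      _ = (Uᴴ * U) * Matrix.diagonal (RCLike.ofReal ∘ hΔ.eigenvalues) * (Uᴴ * U) := by
        simp only [Matrix.mul_assoc]
      _ = _ := by rw [hUU', Matrix.one_mul, Matrix.mul_one]; rfl
  have e1 : frobSq (A - B) = ∑ i, δ i ^ 2 := by
    rw [← frobSq_conj hU', Matrix.conjTranspose_conjTranspose, mul_sub, sub_mul]
    change frobSq (A' - B') = _
    rw [hD, frobSq]
    refine Finset.sum_congr rfl fun i _ => ?_
    rw [Finset.sum_eq_single i]
    · simp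
    · intro j _ hj; simp [Matrix.diagonal_apply_ne _ hj.symm]
    · simp
  have e2 : frobSq (A * A - B * B) = frobSq (A' * A' - B' * B') := by
    rw [← frobSq_conj hU', Matrix.conjTranspose_conjTranspose]
    congr 1
    have h : ∀ Z : Matrix n n ℂ, Uᴴ * Z * U * (Uᴴ * Z * U) = Uᴴ * (Z * Z) * U := fun Z => by
      calc _ = Uᴴ * Z * (U * Uᴴ) * Z * U := by simp only [Matrix.mul_assoc]
        _ = _ := by rw [hUU, Matrix.mul_one]; simp only [Matrix.mul_assoc]
    simp only [A', B', h, mul_sub, sub_mul]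
  rw [e1, e2]
  refine le_trans (Finset.sum_le_sum fun i _ => ?_) (sum_norm_diag_le _)
  have hAB : A' = B' + Matrix.diagonal fun i => (δ i : ℂ) := by rw [← hD]; abel
  have ha : A' i i = B' i i + δ i := by rw [hAB]; simp
  have hdiag : (A' * A' - B' * B') i i = δ i * (A' i i + B' i i) := by
    rw [hAB]
    simp only [add_mul, mul_add, Matrix.sub_apply, Matrix.add_apply, Matrix.diagonal_mul,
      Matrix.mul_diagonal, Matrix.diagonal_apply_eq]
    ring
  have hai := hA'.diag_nonneg (i := i)
  have hbi := hB'.diag_nonneg (i := i)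
  rw [Complex.le_def] at hai hbi
  have har : (A' i i).re = (B' i i).re + δ i := by rw [ha]; simp
  simp only [Complex.zero_re, Complex.zero_im] at hai hbi
  rw [hdiag, norm_mul, Complex.norm_real, Real.norm_eq_abs, ← sq_abs, sq]
  refine mul_le_mul_of_nonneg_left ?_ (abs_nonneg _)
  refine le_trans ?_ (Complex.re_le_norm _)
  rw [Complex.add_re, abs_le]
  constructor <;> linarith [hai.1, hbi.1]

/-- The square root of a positive semidefinite matrix and the pseudo-inverse of that root. -/
theorem exists_sqrt_pinv {ρ : Matrix n n ℂ} (hρ : ρ.PosSemidef) :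
    ∃ A G : Matrix n n ℂ, A.PosSemidef ∧ Gᴴ = G ∧ A * A = ρ ∧ ρ * G = A ∧ G * ρ = A ∧
      (G * ρ * G) * (G * ρ * G) = G * ρ * G ∧ G * G * ρ * (G * G) = G * G := by
  let U : Matrix n n ℂ := hρ.1.eigenvectorUnitary
  have hU : U ∈ Matrix.unitaryGroup n ℂ := hρ.1.eigenvectorUnitary.2
  have hUU' : Uᴴ * U = 1 := Matrix.mem_unitaryGroup_iff'.1 hU
  let e := hρ.1.eigenvalues
  have he : ∀ i, 0 ≤ e i := hρ.eigenvalues_nonneg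
  let f : (n → ℝ) → Matrix n n ℂ := fun g => U * Matrix.diagonal (fun i => (g i : ℂ)) * Uᴴ
  have hf : ∀ g h, f g * f h = f (g * h) := fun g h => by
    calc f g * f h = U * Matrix.diagonal (fun i => (g i : ℂ)) * (Uᴴ * U) *
          Matrix.diagonal (fun i => (h i : ℂ)) * Uᴴ := by simp only [f, Matrix.mul_assoc]
      _ = U * (Matrix.diagonal (fun i => (g i : ℂ)) * Matrix.diagonal (fun i => (h i : ℂ))) * Uᴴ := by
        rw [hUU', Matrix.mul_one]; simp only [Matrix.mul_assoc]
      _ = _ := by rw [Matrix.diagonal_mul_diagonal]; simp [f]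
  have hρf : ρ = f e := by
    have h := hρ.1.spectral_theorem
    rw [Unitary.conjStarAlgAut_apply] at h
    exact h
  have hs : ∀ i, √(e i) * √(e i) = e i := fun i => Real.mul_self_sqrt (he i)
  -- The convention `0⁻¹ = 0` makes the second function the pseudo-inverse on the kernel.
  refine ⟨f fun i => √(e i), f fun i => (√(e i))⁻¹, ?_, ?_, ?_, ?_, ?_, ?_, ?_⟩
  · refine Matrix.PosSemidef.mul_mul_conjTranspose_same (Matrix.PosSemidef.diagonal ?_) U
    intro i
    exact Complex.zero_le_real.2 (Real.sqrt_nonneg _)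
  · simp only [f, Matrix.conjTranspose_mul, Matrix.conjTranspose_conjTranspose,
      Matrix.diagonal_conjTranspose, Matrix.mul_assoc]
    congr 3
    ext i; simp
  · rw [hρf, hf]; exact congrArg f (funext hs)
  all_goals
    rw [hρf]
    simp only [hf]
    congr 1
    ext i
    simp only [Pi.mul_apply]
    have h := hs i
    generalize √(e i) = s at h ⊢
    rw [← h]
    rcases eq_or_ne s 0 with h0 | h0
    · simp [h0]
    · field_simp

theorem posSemidef_one_sub_of_idempotent {P : Matrix n n ℂ} (h1 : Pᴴ = P) (h2 : P * P = P) :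
    (1 - P).PosSemidef := by
  have : (1 - P) = (1 - P)ᴴ * (1 - P) := by
    rw [Matrix.conjTranspose_sub, h1, Matrix.conjTranspose_one]
    simp [mul_sub, sub_mul, h2]
  rw [this]
  exact Matrix.posSemidef_conjTranspose_mul_self _

/-- Uhlmann's theorem for two normalized purifications, with the fidelity bounded below in terms
of the Hilbert--Schmidt distance, and with a contraction in place of a partial isometry. -/
theorem exists_contraction_overlap (S : Matrix n m ℂ) (M : Matrix n l ℂ) (hS : frobSq S = 1)
    (hM : frobSq M = 1) : ∃ V : Matrix m l ℂ, (1 - V * Vᴴ).PosSemidef ∧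
      1 - √(Fintype.card n * frobSq (S * Sᴴ - M * Mᴴ)) / 2 ≤ (Mᴴ * S * V).trace.re := by
  obtain ⟨A, G, hA, hG, hAA, hρG, hGρ, -, hGG⟩ :=
    exists_sqrt_pinv (Matrix.posSemidef_self_mul_conjTranspose S)
  obtain ⟨B, H, hB, hH, hBB, hσH, hHσ, hHH, -⟩ :=
    exists_sqrt_pinv (Matrix.posSemidef_self_mul_conjTranspose M)
  -- With the polar decompositions `S = A (G S)` and `M = B (H M)`, this is the product of the two
  -- partial isometries `(G S)ᴴ` and `H M`. The overlap becomes `tr A B`, and `2 - 2 tr A B = ‖A -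
  -- B‖₂²` for normalized `S` and `M`.
  refine ⟨Sᴴ * G * H * M, ?_, ?_⟩
  · have e : 1 - Sᴴ * G * H * M * (Sᴴ * G * H * M)ᴴ =
        (1 - Sᴴ * G * G * S) + (Sᴴ * G) * (1 - H * (M * Mᴴ) * H) * (Sᴴ * G)ᴴ := by
      simp only [Matrix.conjTranspose_mul, Matrix.conjTranspose_conjTranspose, hG, hH, Matrix.mul_sub,
        Matrix.sub_mul, Matrix.mul_one, Matrix.mul_assoc]
      abel
    rw [e]
    refine (posSemidef_one_sub_of_idempotent ?_ ?_).add
      ((posSemidef_one_sub_of_idempotent ?_ hHH).mul_mul_conjTranspose_same _)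
    · simp only [Matrix.conjTranspose_mul, Matrix.conjTranspose_conjTranspose, hG,
        Matrix.mul_assoc]
    · calc _ = Sᴴ * (G * G * (S * Sᴴ) * (G * G)) * S := by simp only [Matrix.mul_assoc]
        _ = _ := by rw [hGG]; simp only [Matrix.mul_assoc]
    · simp only [Matrix.conjTranspose_mul, Matrix.conjTranspose_conjTranspose, hH,
        Matrix.mul_assoc]
  · have e : (Mᴴ * S * (Sᴴ * G * H * M)).trace = (A * B).trace := by
      calc _ = (Mᴴ * (S * Sᴴ * G * H * M)).trace := by simp only [Matrix.mul_assoc]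
        _ = ((S * Sᴴ * G) * (H * (M * Mᴴ))).trace := by
          rw [Matrix.trace_mul_comm]; simp only [Matrix.mul_assoc]
        _ = _ := by rw [hρG, hHσ]
    rw [e]
    have h1 := frobSq_sub_le hA hB
    rw [frobSq_sub_of_hermitian hA.1 hB.1, hAA, hBB] at h1
    have h2 : (S * Sᴴ).trace.re = 1 := by rw [← ofReal_frobSq, hS]; rfl
    have h3 : (M * Mᴴ).trace.re = 1 := by rw [← ofReal_frobSq, hM]; rfl
    rw [h2, h3] at h1
    linarith

end Uhlmann

/-! ### One receiver: from decoupling to recovered entanglement. -/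

section Receiver

set_option linter.unusedSectionVars false

open scoped ComplexOrder

/-! A pure state of `(R B̃) ⊗ X ⊗ B` is given by its array of coefficients; `K` labels `R`, `T`
labels `B̃`, and `X` is everything the receiver, who holds `B̃` and `B`, does not hold. -/

variable {K T X B D : Type*} [Fintype K] [DecidableEq K] [Fintype T] [DecidableEq T]
  [Fintype X] [DecidableEq X] [Fintype B] [DecidableEq B] [Fintype D]

/-- The action of an operator on `R B̃`. -/
def actOn (U : Matrix (K × T) (K × T) ℂ) (v : K × T → X → B → ℂ) : K × T → X → B → ℂ :=
  fun i x b => ∑ j, U i j * v j x b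

/-- The coefficient matrix of `v` for the bipartition into `R X` and `B B̃`. -/
def receiverMatrix (v : K × T → X → B → ℂ) : Matrix (K × X) (B × T) ℂ :=
  Matrix.of fun p q => v (p.1, q.2) p.2 q.1

/-- The coefficient matrix of `v` for the bipartition into `X` and the rest. -/
def restMatrix (v : K × T → X → B → ℂ) : Matrix X (B × (K × T)) ℂ :=
  Matrix.of fun x q => v q.2 x q.1

/-- The block at `x, x'` of the reduced state on `(R B̃) X`. -/
def reducedBlock (v : K × T → X → B → ℂ) (x x' : X) : Matrix (K × T) (K × T) ℂ :=
  Matrix.of fun i j => ∑ b, v i x b * conj (v j x' b)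

/-- The amplitude at `d, x` of `⟨Φ|^{R B̄} V |v⟩`. -/
def overlap (V : Matrix (K × D) (B × T) ℂ) (v : K × T → X → B → ℂ) (d : D) (x : X) : ℂ :=
  ((1 / √(Fintype.card K : ℝ) : ℝ) : ℂ) * ∑ k, ∑ q, V (k, d) q * v (k, q.2) x q.1

/-- The coefficients of `v` at `x`, as a matrix. -/
def coeffMatrix (v : K × T → X → B → ℂ) (x : X) : Matrix (K × T) B ℂ :=
  Matrix.of fun i b => v i x b

theorem reducedBlock_eq_mul (v : K × T → X → B → ℂ) (x x' : X) :
    reducedBlock v x x' = coeffMatrix v x * (coeffMatrix v x')ᴴ := rfl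

theorem coeffMatrix_actOn (U : Matrix (K × T) (K × T) ℂ) (v : K × T → X → B → ℂ) (x : X) :
    coeffMatrix (actOn U v) x = U * coeffMatrix v x := rfl

theorem reducedBlock_actOn (U : Matrix (K × T) (K × T) ℂ) (v : K × T → X → B → ℂ) (x x' : X) :
    reducedBlock (actOn U v) x x' = U * reducedBlock v x x' * Uᴴ := by
  simp only [reducedBlock_eq_mul, coeffMatrix_actOn, Matrix.conjTranspose_mul, Matrix.mul_assoc]

theorem frobSq_receiverMatrix (v : K × T → X → B → ℂ) :
    frobSq (receiverMatrix v) = ∑ i, ∑ x, ∑ b, ‖v i x b‖ ^ 2 := by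
  simp only [frobSq, receiverMatrix, Matrix.of_apply, Fintype.sum_prod_type]
  refine Finset.sum_congr rfl fun k _ => ?_
  rw [Finset.sum_comm (s := (Finset.univ : Finset T))]
  refine Finset.sum_congr rfl fun x _ => ?_
  rw [Finset.sum_comm]

theorem frobSq_restMatrix (v : K × T → X → B → ℂ) :
    frobSq (restMatrix v) = ∑ i, ∑ x, ∑ b, ‖v i x b‖ ^ 2 := by
  simp only [frobSq, restMatrix, Matrix.of_apply, Fintype.sum_prod_type_right (α₁ := B)]
  rw [Finset.sum_comm]

/-- The Gram matrix is the reduced state on `R X`, whose `x, x'` block is the partial trace over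
`B̃` of the corresponding block on `R B̃ X`. This puts the purity in the form handled by the
decoupling lemma. -/
theorem frobSq_receiverMatrix_gram (v : K × T → X → B → ℂ) :
    frobSq (receiverMatrix v * (receiverMatrix v)ᴴ) =
      ∑ c : X × X, marginalSq (reducedBlock v c.1 c.2) := by
  have h : ∀ k x k' x', (receiverMatrix v * (receiverMatrix v)ᴴ) (k, x) (k', x') =
      ∑ t, reducedBlock v x x' (k, t) (k', t) := fun k x k' x' => by
    simp only [Matrix.mul_apply, Fintype.sum_prod_type_right (α₁ := B)]
    rfl
  simp only [frobSq, Fintype.sum_prod_type, h, marginalSq]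
  rw [Finset.sum_comm]
  refine Finset.sum_congr rfl fun x _ => ?_
  rw [Finset.sum_congr rfl fun k _ => Finset.sum_comm, Finset.sum_comm]

theorem trace_reducedBlock (v : K × T → X → B → ℂ) (x x' : X) :
    (reducedBlock v x x').trace = (restMatrix v * (restMatrix v)ᴴ) x x' := by
  simp only [Matrix.mul_apply, Fintype.sum_prod_type_right (α₁ := B)]
  rfl

theorem sum_receiverMatrix_gram (v : K × T → X → B → ℂ) (x x' : X) :
    ∑ k, (receiverMatrix v * (receiverMatrix v)ᴴ) (k, x) (k, x') =
      (restMatrix v * (restMatrix v)ᴴ) x x' := by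
  simp only [Matrix.mul_apply, Fintype.sum_prod_type_right (α₁ := B)]
  rw [Fintype.sum_prod_type (α₁ := K)]
  rfl

theorem sum_norm_sq_actOn {U : Matrix (K × T) (K × T) ℂ} (hU : U ∈ Matrix.unitaryGroup (K × T) ℂ)
    (v : K × T → X → B → ℂ) :
    ∑ i, ∑ x, ∑ b, ‖actOn U v i x b‖ ^ 2 = ∑ i, ∑ x, ∑ b, ‖v i x b‖ ^ 2 := by
  have h : ∀ w : K × T → X → B → ℂ, ((∑ i, ∑ x, ∑ b, ‖w i x b‖ ^ 2 : ℝ) : ℂ) =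
      ∑ x, (reducedBlock w x x).trace := fun w => by
    rw [Finset.sum_comm]
    push_cast
    simp only [reducedBlock_eq_mul, ← ofReal_frobSq, frobSq, coeffMatrix, Matrix.of_apply]
    push_cast
    rfl
  apply Complex.ofReal_injective
  rw [h, h]
  simp only [reducedBlock_actOn, trace_conj hU]

/-- A purification of `π^R ⊗ v^X` in which `v` itself purifies `v^X`. -/
def productMatrix (v : K × T → X → B → ℂ) : Matrix (K × X) (K × (B × (K × T))) ℂ :=
  Matrix.of fun p q => if p.1 = q.1 then
    ((1 / √(Fintype.card K : ℝ) : ℝ) : ℂ) * restMatrix v p.2 q.2 else 0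

theorem sq_maxEnt_coeff {K : Type*} [Fintype K] [Nonempty K] : ((1 / √(Fintype.card K : ℝ) : ℝ) : ℂ) *
    ((1 / √(Fintype.card K : ℝ) : ℝ) : ℂ) = 1 / (Fintype.card K : ℂ) := by
  rw [← Complex.ofReal_mul, div_mul_div_comm, Real.mul_self_sqrt (by positivity)]
  push_cast; simp

theorem productMatrix_gram [Nonempty K] (v : K × T → X → B → ℂ) (p q : K × X) :
    (productMatrix v * (productMatrix v)ᴴ) p q = if p.1 = q.1 then
      1 / (Fintype.card K : ℂ) * (restMatrix v * (restMatrix v)ᴴ) p.2 q.2 else 0 := by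
  simp only [Matrix.mul_apply, Matrix.conjTranspose_apply, productMatrix, Matrix.of_apply,
    Fintype.sum_prod_type (α₁ := K)]
  rw [Finset.sum_eq_single p.1]
  · by_cases h : p.1 = q.1
    · simp only [h, if_true, Finset.mul_sum, ← sq_maxEnt_coeff]
      refine Finset.sum_congr rfl fun y _ => ?_
      rw [star_mul', Complex.star_def, Complex.conj_ofReal]
      ring
    · simp [h, Ne.symm h]
  · intro k _ hk; simp [Ne.symm hk]
  · simp

theorem frobSq_productMatrix [Nonempty K] (v : K × T → X → B → ℂ) :
    frobSq (productMatrix v) = ∑ i, ∑ x, ∑ b, ‖v i x b‖ ^ 2 := by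
  apply Complex.ofReal_injective
  have hK : (Fintype.card K : ℂ) ≠ 0 := by exact_mod_cast Fintype.card_ne_zero
  rw [ofReal_frobSq, ← frobSq_restMatrix, ofReal_frobSq]
  simp only [Matrix.trace, Matrix.diag, productMatrix_gram, if_true, Fintype.sum_prod_type,
    Finset.sum_const, Finset.card_univ, ← Finset.mul_sum, nsmul_eq_mul]
  field_simp

/-- Both `tr ρ^{RX} (π ⊗ ρ^X)` and `tr (π ⊗ ρ^X)²` equal `tr (ρ^X)² / |K|`, because `π` is a
multiple of the identity and `ρ^X` is the marginal of `ρ^{RX}`. -/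
theorem frobSq_gram_sub [Nonempty K] (v : K × T → X → B → ℂ) :
    frobSq (receiverMatrix v * (receiverMatrix v)ᴴ - productMatrix v * (productMatrix v)ᴴ) =
      frobSq (receiverMatrix v * (receiverMatrix v)ᴴ) -
        frobSq (restMatrix v * (restMatrix v)ᴴ) / Fintype.card K := by
  have hK : (Fintype.card K : ℂ) ≠ 0 := by exact_mod_cast Fintype.card_ne_zero
  set N := restMatrix v * (restMatrix v)ᴴ with hN
  have hNH : Nᴴ = N := by simp [hN]
  have h1 : (receiverMatrix v * (receiverMatrix v)ᴴ)ᴴ = receiverMatrix v * (receiverMatrix v)ᴴ := by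
    simp
  have h2 : (productMatrix v * (productMatrix v)ᴴ)ᴴ = productMatrix v * (productMatrix v)ᴴ := by
    simp
  have key : ∀ S : Matrix (K × X) (K × X) ℂ,
      (S * (productMatrix v * (productMatrix v)ᴴ)).trace =
        1 / (Fintype.card K : ℂ) * ∑ x, ∑ x', (∑ k, S (k, x) (k, x')) * N x' x := fun S => by
    simp only [Matrix.trace, Matrix.diag, Matrix.mul_apply (M := S), productMatrix_gram,
      Fintype.sum_prod_type, ← hN]
    simp only [mul_ite, mul_zero, Finset.sum_ite_irrel, Finset.sum_const_zero,
      Finset.sum_ite_eq', Finset.mem_univ, if_true]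
    rw [Finset.sum_comm, Finset.mul_sum]
    refine Finset.sum_congr rfl fun x _ => ?_
    rw [Finset.sum_comm, Finset.mul_sum]
    refine Finset.sum_congr rfl fun x' _ => ?_
    rw [Finset.sum_mul, Finset.mul_sum]
    exact Finset.sum_congr rfl fun k _ => by ring
  have hNN : ∑ x, ∑ x', N x x' * N x' x = (frobSq N : ℂ) := by
    rw [ofReal_frobSq, hNH]
    rfl
  have hfrob : ∀ S : Matrix (K × X) (K × X) ℂ, Sᴴ = S → (S * S).trace.re = frobSq S :=
    fun S hS => by
      nth_rewrite 2 [← hS]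
      rw [← ofReal_frobSq, Complex.ofReal_re]
  have k1 : (receiverMatrix v * (receiverMatrix v)ᴴ *
      (productMatrix v * (productMatrix v)ᴴ)).trace = ((frobSq N / Fintype.card K : ℝ) : ℂ) := by
    rw [key]
    simp only [sum_receiverMatrix_gram, ← hN, hNN]
    push_cast; ring
  have k2 : (productMatrix v * (productMatrix v)ᴴ *
      (productMatrix v * (productMatrix v)ᴴ)).trace = ((frobSq N / Fintype.card K : ℝ) : ℂ) := by
    rw [key]
    simp only [productMatrix_gram, if_true, Finset.sum_const, Finset.card_univ, nsmul_eq_mul, ← hN]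
    have : ∀ x x', (Fintype.card K : ℂ) * (1 / Fintype.card K * N x x') * N x' x =
        N x x' * N x' x := fun x x' => by field_simp
    simp only [this, hNN]
    push_cast; ring
  rw [frobSq_sub_of_hermitian h1 h2, k1, k2, hfrob _ h1, Complex.ofReal_re]
  ring

/-- A contraction dilates to an isometry by adding a copy of the input to the output. -/
theorem exists_isometry_dilation [Nonempty K] (V : Matrix (B × T) (K × D) ℂ)
    (hV : (1 - V * Vᴴ).PosSemidef) :
    ∃ W : Matrix (K × (D ⊕ (B × T))) (B × T) ℂ, IsIsometry W ∧
      ∀ k d q, W (k, Sum.inl d) q = V q (k, d) := by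
  obtain ⟨k₀⟩ := ‹Nonempty K›
  -- `R` is the defect operator of the contraction `Vᵀ`. Its output goes to the added summand, next
  -- to the fixed vector `k₀` of the `K` factor.
  obtain ⟨R, -, hR, -, hRR, -⟩ := exists_sqrt_pinv hV.transpose
  let W : Matrix (K × (D ⊕ (B × T))) (B × T) ℂ := Matrix.of fun p q =>
    Sum.elim (fun d => V q (p.1, d)) (fun r => if p.1 = k₀ then R r q else 0) p.2
  refine ⟨W, ?_, fun k d q => rfl⟩
  ext q q'
  have h : ∑ r, star (R r q) * R r q' = (1 : Matrix (B × T) (B × T) ℂ) q q' -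
      ∑ p, V q' p * star (V q p) := by
    have e := congrFun (congrFun hRR q) q'
    nth_rewrite 1 [← show Rᴴ = R from hR.1] at e
    rw [Matrix.transpose_sub, Matrix.transpose_one] at e
    exact e
  have hr : ∑ k, ∑ r, star (W (k, Sum.inr r) q) * W (k, Sum.inr r) q' =
      ∑ r, star (R r q) * R r q' := by
    rw [Finset.sum_eq_single k₀]
    · simp [W]
    · intro k _ hk; simp [W, hk]
    · simp
  have hl : ∑ k, ∑ d, star (W (k, Sum.inl d) q) * W (k, Sum.inl d) q' =
      ∑ p, V q' p * star (V q p) := by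
    rw [Fintype.sum_prod_type]
    exact Finset.sum_congr rfl fun k _ => Finset.sum_congr rfl fun d _ => mul_comm _ _
  simp only [Matrix.mul_apply, Matrix.conjTranspose_apply, Fintype.sum_prod_type (α₁ := K),
    Fintype.sum_sum_type, Finset.sum_add_distrib]
  rw [hl, hr, h]
  ring

theorem sum_norm_sq_mul_conj_le {ι : Type*} [Fintype ι] (a b : ι → ℂ) :
    ‖∑ i, conj (a i) * b i‖ ^ 2 ≤ (∑ i, ‖a i‖ ^ 2) * ∑ i, ‖b i‖ ^ 2 := by
  calc _ ≤ (∑ i, ‖a i‖ * ‖b i‖) ^ 2 := by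
        refine pow_le_pow_left₀ (norm_nonneg _) ((norm_sum_le _ _).trans_eq ?_) 2
        simp
    _ ≤ _ := Finset.sum_mul_sq_le_sq_mul_sq _ _ _

/-- The purification `productMatrix v` is `Φ ⊗ v`, so the Uhlmann overlap is the inner product of
`v` with the component of the decoded state along `Φ`. Cauchy–Schwarz then bounds the weight of that
component from below. -/
theorem trace_productMatrix_mul (v : K × T → X → B → ℂ)
    (V : Matrix (B × T) (K × (B × (K × T))) ℂ) :
    ((productMatrix v)ᴴ * receiverMatrix v * V).trace =
      ∑ p : X × (B × (K × T)), conj (restMatrix v p.1 p.2) * overlap Vᵀ v p.2 p.1 := by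
  rw [Matrix.mul_assoc, Matrix.trace_mul_comm]
  have h : ∀ k x, (receiverMatrix v * V * (productMatrix v)ᴴ) (k, x) (k, x) =
      ∑ δ, conj (restMatrix v x δ) * (((1 / √(Fintype.card K : ℝ) : ℝ) : ℂ) *
        ∑ q, V q (k, δ) * v (k, q.2) x q.1) := fun k x => by
    simp only [Matrix.mul_apply (M := receiverMatrix v * V), Fintype.sum_prod_type (α₁ := K),
      Matrix.conjTranspose_apply, productMatrix, Matrix.of_apply]
    rw [Finset.sum_eq_single k]
    · refine Finset.sum_congr rfl fun δ _ => ?_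
      simp only [if_true, Matrix.mul_apply, receiverMatrix, Matrix.of_apply]
      rw [star_mul', Complex.star_def, Complex.conj_ofReal, Finset.sum_mul, Finset.mul_sum,
        Finset.mul_sum]
      exact Finset.sum_congr rfl fun q _ => by ring
    · intro k' _ hk; simp [Ne.symm hk]
    · simp
  simp only [Matrix.trace, Matrix.diag, Fintype.sum_prod_type (α₁ := K), h,
    Fintype.sum_prod_type (α₁ := X), overlap, Finset.mul_sum, Matrix.transpose_apply]
  rw [Finset.sum_comm]
  refine Finset.sum_congr rfl fun x _ => ?_
  rw [Finset.sum_comm]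

/-- One receiver can recover maximal entanglement with `R` after a suitable unitary on `R B̃`, up
to an error governed by the purity of the reduced state on `R B̃ X`. -/
theorem exists_unitary_isometry_overlap [Nonempty K] [Nonempty T] (v : K × T → X → B → ℂ)
    (hv : ∑ i, ∑ x, ∑ b, ‖v i x b‖ ^ 2 = 1) :
    ∃ U ∈ Matrix.unitaryGroup (K × T) ℂ, ∃ (d : ℕ) (V : Matrix (K × Fin d) (B × T) ℂ),
      IsIsometry V ∧
      1 - √(Fintype.card K * Fintype.card X * (∑ c : X × X, frobSq (reducedBlock v c.1 c.2)) /
        Fintype.card T) ≤ ∑ d, ∑ x, ‖overlap V (actOn U v) d x‖ ^ 2 := by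
  obtain ⟨U, hU, hUle⟩ := exists_unitary_marginalSq_le fun c : X × X => reducedBlock v c.1 c.2
  let w := actOn U v
  have hw : ∑ i, ∑ x, ∑ b, ‖w i x b‖ ^ 2 = 1 := (sum_norm_sq_actOn hU v).trans hv
  obtain ⟨V₀, hV₀, hov⟩ := exists_contraction_overlap (receiverMatrix w) (productMatrix w)
    ((frobSq_receiverMatrix w).trans hw) ((frobSq_productMatrix w).trans hw)
  obtain ⟨W, hW, hWV⟩ := exists_isometry_dilation V₀ hV₀
  let e := Fintype.equivFin ((B × (K × T)) ⊕ (B × T))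
  have hK : (0 : ℝ) < Fintype.card K := by exact_mod_cast Fintype.card_pos
  -- The trace term of the decoupling bound equals the subtracted `‖w^X‖₂² / |K|`, since `U` does
  -- not change the state on `X`; only the purity over `|T|` remains.
  have hΔ : frobSq (receiverMatrix w * (receiverMatrix w)ᴴ - productMatrix w * (productMatrix w)ᴴ) ≤
      (∑ c : X × X, frobSq (reducedBlock v c.1 c.2)) / Fintype.card T := by
    rw [frobSq_gram_sub, frobSq_receiverMatrix_gram]
    simp only [← reducedBlock_actOn, Finset.sum_add_distrib, ← Finset.sum_div] at hUle
    have : ∑ c : X × X, ‖(reducedBlock v c.1 c.2).trace‖ ^ 2 =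
        frobSq (restMatrix w * (restMatrix w)ᴴ) := by
      rw [frobSq, ← Fintype.sum_prod_type']
      refine Finset.sum_congr rfl fun c _ => ?_
      rw [← trace_reducedBlock, reducedBlock_actOn, trace_conj hU]
    rw [this] at hUle
    linarith
  refine ⟨U, hU, _, W.submatrix (Prod.map id e.symm) id, ?_, ?_⟩
  · have h : IsIsometry W := hW
    rw [IsIsometry] at h ⊢
    rw [← h]
    ext q q'
    simp only [Matrix.mul_apply, Matrix.conjTranspose_apply, Matrix.submatrix_apply]
    exact Fintype.sum_equiv (Equiv.prodCongr (Equiv.refl K) e.symm) _ _ fun p => rfl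
  · have h1 : ∑ d, ∑ x, ‖overlap (W.submatrix (Prod.map id e.symm) id) w d x‖ ^ 2 =
        ∑ d, ∑ x, ‖overlap W w d x‖ ^ 2 :=
      Fintype.sum_equiv e.symm _ _ fun d => rfl
    have h2 : ∑ p : X × (B × (K × T)), ‖overlap V₀ᵀ w p.2 p.1‖ ^ 2 ≤
        ∑ d, ∑ x, ‖overlap W w d x‖ ^ 2 := by
      rw [Fintype.sum_sum_type, Fintype.sum_prod_type_right]
      have : ∀ d x, overlap W w (Sum.inl d) x = overlap V₀ᵀ w d x := fun d x => by
        simp only [overlap, hWV, Matrix.transpose_apply]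
      simp only [this]
      exact le_add_of_nonneg_right
        (Finset.sum_nonneg fun _ _ => Finset.sum_nonneg fun _ _ => by positivity)
    have h3 : ‖((productMatrix w)ᴴ * receiverMatrix w * V₀).trace‖ ^ 2 ≤
        ∑ p : X × (B × (K × T)), ‖overlap V₀ᵀ w p.2 p.1‖ ^ 2 := by
      rw [trace_productMatrix_mul]
      refine (sum_norm_sq_mul_conj_le _ _).trans_eq ?_
      rw [Fintype.sum_prod_type' (fun x y => ‖restMatrix w x y‖ ^ 2)]
      change frobSq (restMatrix w) * _ = _
      rw [frobSq_restMatrix, hw, one_mul]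
    change _ ≤ ∑ d, ∑ x, ‖overlap (W.submatrix (Prod.map id e.symm) id) w d x‖ ^ 2
    rw [h1]
    refine le_trans ?_ (h3.trans h2)
    set s := √(Fintype.card K * Fintype.card X * (∑ c : X × X, frobSq (reducedBlock v c.1 c.2)) /
        Fintype.card T)
    have hs : √(Fintype.card (K × X) * frobSq (receiverMatrix w * (receiverMatrix w)ᴴ -
        productMatrix w * (productMatrix w)ᴴ)) ≤ s := by
      apply Real.sqrt_le_sqrt
      rw [Fintype.card_prod, mul_div_assoc]
      push_cast
      exact mul_le_mul_of_nonneg_left hΔ (by positivity)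
    have h4 : 1 - s / 2 ≤ ‖((productMatrix w)ᴴ * receiverMatrix w * V₀).trace‖ :=
      (by linarith : 1 - s / 2 ≤ _).trans (Complex.re_le_norm _)
    -- Squaring uses `(1 - s/2)² ≥ 1 - s`, and needs the base to be nonnegative; otherwise `1 - s`
    -- is negative and nothing is claimed.
    by_cases h5 : 1 - s / 2 ≤ 0
    · have : 0 ≤ ‖((productMatrix w)ᴴ * receiverMatrix w * V₀).trace‖ ^ 2 := by positivity
      linarith
    · nlinarith [pow_le_pow_left₀ (not_le.1 h5).le h4 2, sq_nonneg s]

end Receiver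

/-! ### Trace distance of pure states. -/

section TraceNorm

set_option linter.unusedSectionVars false

theorem dotProduct_star_self_eq {X : Type*} [Fintype X] (v : X → ℂ) : star v ⬝ᵥ v = ((∑ i, ‖v i‖ ^ 2 : ℝ) : ℂ) := by
  push_cast
  refine Finset.sum_congr rfl fun i _ => ?_
  rw [← Complex.ofReal_pow, norm_sq_eq_mul_conj, mul_comm]; rfl

variable {X : Type*} [Fintype X] [DecidableEq X]

theorem vecMulVec_mul_vecMulVec_eq_smul (a b c d : X → ℂ) :
    Matrix.vecMulVec a b * Matrix.vecMulVec c d = (b ⬝ᵥ c) • Matrix.vecMulVec a d := by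
  ext i j
  simp only [Matrix.mul_apply, Matrix.vecMulVec_apply, Matrix.smul_apply, dotProduct, smul_eq_mul,
    Finset.sum_mul]
  exact Finset.sum_congr rfl fun k _ => by ring

theorem ketBra_mul_ketBra (v w : X → ℂ) :
    ketBra v * ketBra w = (star v ⬝ᵥ w) • Matrix.vecMulVec v (star w) := by
  rw [ketBra, ketBra, vecMulVec_mul_vecMulVec_eq_smul]

theorem ketBra_conjTranspose (v : X → ℂ) : (ketBra v)ᴴ = ketBra v := by
  rw [ketBra, Matrix.conjTranspose_vecMulVec, star_star]

theorem trace_ketBra (v : X → ℂ) : (ketBra v).trace = star v ⬝ᵥ v := by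
  rw [ketBra, Matrix.trace_vecMulVec, dotProduct_comm]

open scoped MatrixOrder ComplexOrder in
/-- The trace distance of two pure states. -/
theorem traceNorm_ketBra_sub {w v : X → ℂ} (hw : star w ⬝ᵥ w = 1) (hv : star v ⬝ᵥ v = 1)
    (hle : ‖star v ⬝ᵥ w‖ ^ 2 ≤ 1) :
    traceNorm (ketBra w - ketBra v) = 2 * √(1 - ‖star v ⬝ᵥ w‖ ^ 2) := by
  have hXX : ketBra w * ketBra w = ketBra w := by
    rw [ketBra_mul_ketBra, hw, one_smul]; rfl
  have hYY : ketBra v * ketBra v = ketBra v := by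
    rw [ketBra_mul_ketBra, hv, one_smul]; rfl
  set X' := ketBra w with hX
  set Y' := ketBra v with hY
  set r : ℝ := ‖star v ⬝ᵥ w‖ ^ 2 with hr
  have hc : star w ⬝ᵥ v = conj (star v ⬝ᵥ w) := by
    rw [starRingEnd_apply, ← Matrix.star_dotProduct_star, star_star]
  have hrc : (star w ⬝ᵥ v) * (star v ⬝ᵥ w) = (r : ℂ) := by
    rw [hr, norm_sq_eq_mul_conj, hc, mul_comm]
  have hXYX : X' * Y' * X' = (r : ℂ) • X' := by
    rw [hX, hY, ketBra_mul_ketBra, ketBra, Matrix.smul_mul, vecMulVec_mul_vecMulVec_eq_smul,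
      smul_smul, hrc]
  have hYXY : Y' * X' * Y' = (r : ℂ) • Y' := by
    rw [hX, hY, ketBra_mul_ketBra, ketBra, Matrix.smul_mul, vecMulVec_mul_vecMulVec_eq_smul,
      smul_smul, mul_comm, hrc]
  set M := X' - Y' with hM
  have hMH : Mᴴ = M := by
    rw [hM, Matrix.conjTranspose_sub, hX, hY, ketBra_conjTranspose, ketBra_conjTranspose]
  -- The nonzero eigenvalues of `M` can only be `±√(1 - r)`, so `|M| = M² / √(1 - r)` when `r < 1`,
  -- and the trace of `M²` gives the norm.
  have hM3 : M * (M * M) = ((1 - r : ℝ) : ℂ) • M := by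
    have : M * (M * M) = X' * X' * X' - X' * X' * Y' - X' * Y' * X' + X' * (Y' * Y') - Y' * (X' * X')
        + Y' * X' * Y' + (Y' * Y') * X' - Y' * Y' * Y' := by
      rw [hM]; noncomm_ring
    rw [this, hXYX, hYXY]
    simp only [hXX, hYY]
    push_cast
    rw [hM]
    module
  have htr : (M * M).trace = ((2 * (1 - r) : ℝ) : ℂ) := by
    have : M * M = X' * X' - X' * Y' - Y' * X' + Y' * Y' := by rw [hM]; noncomm_ring
    rw [this, hXX, hYY, Matrix.trace_add, Matrix.trace_sub, Matrix.trace_sub,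
      Matrix.trace_mul_comm Y' X', hX, hY, trace_ketBra, trace_ketBra, hw, hv, ketBra_mul_ketBra,
      Matrix.trace_smul, Matrix.trace_vecMulVec, dotProduct_comm w, smul_eq_mul, hrc]
    push_cast; ring
  have hpos : (M * M).PosSemidef := by
    nth_rewrite 1 [← hMH]; exact Matrix.posSemidef_conjTranspose_mul_self M
  rw [traceNorm, CFC.abs]
  rcases hle.lt_or_eq with hlt | heq
  · have hl : 0 < 1 - r := by linarith
    set s := √(1 - r) with hs
    have hs0 : 0 < s := Real.sqrt_pos.2 hl
    have hss : s * s = 1 - r := Real.mul_self_sqrt hl.le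
    have habs : CFC.sqrt (star M * M) = ((s⁻¹ : ℝ) : ℂ) • (M * M) := by
      apply CFC.sqrt_unique
      · rw [Matrix.smul_mul, Matrix.mul_smul, smul_smul, Matrix.mul_assoc, hM3, Matrix.mul_smul,
          smul_smul, Matrix.star_eq_conjTranspose, hMH, ← Complex.ofReal_mul, ← Complex.ofReal_mul,
          ← hss]
        rw [show s⁻¹ * s⁻¹ * (s * s) = 1 by field_simp]
        simp
      · rw [Matrix.nonneg_iff_posSemidef]
        exact hpos.smul (Complex.zero_le_real.2 (inv_nonneg.2 hs0.le))
    rw [habs, Matrix.trace_smul, htr, smul_eq_mul, ← Complex.ofReal_mul, Complex.ofReal_re, ← hss]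
    field_simp
  · have hM0 : M * M = 0 := by
      rw [← hpos.trace_eq_zero_iff, htr, heq]; simp
    rw [Matrix.star_eq_conjTranspose, hMH, hM0, heq]
    simp

end TraceNorm

/-! ### Local unitaries and decoders acting on amplitudes. -/

section LocalOperations

set_option linter.unusedSectionVars false

variable {K T B D : Type*} [Fintype K] [DecidableEq K] [Fintype T] [DecidableEq T]
  [Fintype B] [DecidableEq B] [Fintype D] [DecidableEq D]

/-- The action of `U` on `R B̃` followed by `V` on `B B̃`. -/
def localOp (U : Matrix (K × T) (K × T) ℂ) (V : Matrix (K × D) (B × T) ℂ) (a : K × T → B → ℂ) :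
    K → K × D → ℂ :=
  fun r p => ∑ q : B × T, V p q * ∑ j, U (r, q.2) j * a j q.1

/-- The component of `localOp U V a` along the maximally entangled state. -/
def localOverlap (U : Matrix (K × T) (K × T) ℂ) (V : Matrix (K × D) (B × T) ℂ)
    (a : K × T → B → ℂ) (d : D) : ℂ :=
  ((1 / √(Fintype.card K : ℝ) : ℝ) : ℂ) * ∑ k, localOp U V a k (k, d)

theorem sum_norm_sq_isometry {X Y : Type*} [Fintype X] [DecidableEq X] [Fintype Y]
    {V : Matrix Y X ℂ} (hV : IsIsometry V) (f : X → ℂ) :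
    ∑ p, ‖∑ q, V p q * f q‖ ^ 2 = ∑ q, ‖f q‖ ^ 2 := by
  apply Complex.ofReal_injective
  rw [← dotProduct_star_self_eq, ← dotProduct_star_self_eq]
  change star (V *ᵥ f) ⬝ᵥ (V *ᵥ f) = _
  rw [Matrix.star_mulVec, Matrix.dotProduct_mulVec, Matrix.vecMul_vecMul, hV, Matrix.vecMul_one]

theorem sum_norm_sq_localOp {U : Matrix (K × T) (K × T) ℂ} (hU : U ∈ Matrix.unitaryGroup (K × T) ℂ)
    {V : Matrix (K × D) (B × T) ℂ} (hV : IsIsometry V) (a : K × T → B → ℂ) :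
    ∑ r, ∑ p, ‖localOp U V a r p‖ ^ 2 = ∑ i, ∑ b, ‖a i b‖ ^ 2 := by
  simp only [localOp, sum_norm_sq_isometry hV fun q : B × T => ∑ j, U (_, q.2) j * a j q.1]
  rw [Finset.sum_congr rfl fun r _ => Fintype.sum_prod_type_right _,
    ← Fintype.sum_prod_type' fun r t => ∑ b, ‖∑ j, U (r, t) j * a j b‖ ^ 2, Finset.sum_comm,
    Finset.sum_comm (s := (Finset.univ : Finset (K × T)))]
  exact Finset.sum_congr rfl fun b _ =>
    sum_norm_sq_isometry (V := U) (Matrix.mem_unitaryGroup_iff'.1 hU) fun j => a j b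

theorem localOp_sum {ι : Type*} (s : Finset ι) (U : Matrix (K × T) (K × T) ℂ)
    (V : Matrix (K × D) (B × T) ℂ) (c : ι → ℂ) (a : ι → K × T → B → ℂ) (r : K) (p : K × D) :
    localOp U V (fun j b => ∑ i ∈ s, c i * a i j b) r p = ∑ i ∈ s, c i * localOp U V (a i) r p := by
  have h : ∀ q : B × T, ∑ j, U (r, q.2) j * ∑ i ∈ s, c i * a i j q.1 =
      ∑ i ∈ s, c i * ∑ j, U (r, q.2) j * a i j q.1 := fun q => by
    simp only [Finset.mul_sum]
    rw [Finset.sum_comm]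
    exact Finset.sum_congr rfl fun i _ => Finset.sum_congr rfl fun j _ => by ring
  simp only [localOp, h]
  simp only [Finset.mul_sum (s := s)]
  rw [Finset.sum_comm]
  refine Finset.sum_congr rfl fun i _ => ?_
  rw [Finset.mul_sum]
  exact Finset.sum_congr rfl fun q _ => by ring

theorem localOp_one (V : Matrix (K × D) (B × T) ℂ) (a : K × T → B → ℂ) (r : K) (p : K × D) :
    localOp 1 V a r p = ∑ q : B × T, V p q * a (r, q.2) q.1 := by
  simp [localOp, Matrix.one_apply]

end LocalOperations

/-! ### Rank-one projections and the union bound. -/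

theorem sum_norm_sq_sub_proj {X : Type*} [Fintype X] {f : X → ℂ} (hf : ∑ i, ‖f i‖ ^ 2 = 1)
    (u : X → ℂ) : ∑ i, ‖u i - (∑ j, conj (f j) * u j) * f i‖ ^ 2 =
      ∑ i, ‖u i‖ ^ 2 - ‖∑ j, conj (f j) * u j‖ ^ 2 := by
  apply Complex.ofReal_injective
  have hf' : ∑ i, conj (f i) * f i = 1 := by
    rw [← Complex.ofReal_one, ← hf]; push_cast
    refine Finset.sum_congr rfl fun i _ => ?_
    rw [← Complex.ofReal_pow, norm_sq_eq_mul_conj, mul_comm]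
  set c := ∑ j, conj (f j) * u j with hc
  have hc' : ∑ j, f j * conj (u j) = conj c := by simp [hc, map_sum]
  push_cast
  simp only [← Complex.ofReal_pow, norm_sq_eq_mul_conj]
  have : ∀ i, (u i - c * f i) * conj (u i - c * f i) = u i * conj (u i) -
      conj c * (conj (f i) * u i) - c * (f i * conj (u i)) +
        c * conj c * (conj (f i) * f i) := fun i => by
    simp only [map_sub, map_mul]; ring
  simp only [this, Finset.sum_add_distrib, Finset.sum_sub_distrib, ← Finset.mul_sum, hf', hc', ← hc]
  ring

/-- A union bound for the commuting projections onto `f ⊗ Y` and `X ⊗ g`. -/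
theorem norm_sq_overlap_ge {X Y : Type*} [Fintype X] [Fintype Y] {f : X → ℂ} {g : Y → ℂ}
    (hf : ∑ i, ‖f i‖ ^ 2 = 1) (hg : ∑ i, ‖g i‖ ^ 2 = 1) (m : X → Y → ℂ) :
    ∑ j, ‖∑ i, conj (f i) * m i j‖ ^ 2 + ∑ i, ‖∑ j, conj (g j) * m i j‖ ^ 2 -
      ∑ i, ∑ j, ‖m i j‖ ^ 2 ≤ ‖∑ i, conj (f i) * ∑ j, conj (g j) * m i j‖ ^ 2 := by
  -- With `P`, `Q` the projections for `f`, `g` and `n = (1 - Q) m`: `‖P m‖² - ‖P Q m‖² = ‖P n‖² ≤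
  -- ‖n‖² = ‖m‖² - ‖Q m‖²`.
  let n : X → Y → ℂ := fun i j => m i j - (∑ j', conj (g j') * m i j') * g j
  have h1 := sum_norm_sq_sub_proj hg fun j => ∑ i, conj (f i) * m i j
  have e1 : ∑ j, conj (g j) * ∑ i, conj (f i) * m i j =
      ∑ i, conj (f i) * ∑ j, conj (g j) * m i j := by
    simp only [Finset.mul_sum]
    rw [Finset.sum_comm]
    exact Finset.sum_congr rfl fun i _ => Finset.sum_congr rfl fun j _ => by ring
  have e2 : ∀ j, (∑ i, conj (f i) * m i j) - (∑ j, conj (g j) * ∑ i, conj (f i) * m i j) * g j =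
      ∑ i, conj (f i) * n i j := fun j => by
    rw [e1, Finset.sum_mul, ← Finset.sum_sub_distrib]
    exact Finset.sum_congr rfl fun i _ => by ring
  simp only [e2] at h1
  rw [e1] at h1
  have h2 : ∀ j, ‖∑ i, conj (f i) * n i j‖ ^ 2 ≤ ∑ i, ‖n i j‖ ^ 2 := fun j => by
    have := sum_norm_sq_mul_conj_le f fun i => n i j
    rwa [hf, one_mul] at this
  have h3 := Finset.sum_le_sum fun j (_ : j ∈ Finset.univ) => h2 j
  rw [Finset.sum_comm] at h3
  simp only [n, sum_norm_sq_sub_proj hg, Finset.sum_sub_distrib] at h3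
  linarith

/-! ### The maximally entangled vector. -/

section MaxEnt

theorem sum_maxEnt_mul {K : Type*} [Fintype K] [DecidableEq K] (F : K × K → ℂ) :
    ∑ i, conj (maxEnt K i) * F i =
      ((1 / √(Fintype.card K : ℝ) : ℝ) : ℂ) * ∑ k, F (k, k) := by
  simp only [maxEnt, Fintype.sum_prod_type, Finset.mul_sum, apply_ite conj, Complex.conj_ofReal,
    map_zero, ite_mul, zero_mul, Finset.sum_ite_eq, Finset.mem_univ, if_true]

theorem sum_norm_sq_maxEnt (K : Type*) [Fintype K] [DecidableEq K] [Nonempty K] :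
    ∑ i, ‖maxEnt K i‖ ^ 2 = 1 := by
  have h : ∑ i, conj (maxEnt K i) * maxEnt K i = 1 := by
    rw [sum_maxEnt_mul]
    simp only [maxEnt, if_true, Finset.sum_const, Finset.card_univ, nsmul_eq_mul]
    rw [mul_left_comm, sq_maxEnt_coeff]
    have hK : (Fintype.card K : ℂ) ≠ 0 := by exact_mod_cast Fintype.card_ne_zero
    field_simp
  apply Complex.ofReal_injective
  rw [← dotProduct_star_self_eq]
  exact h

end MaxEnt

/-! ### Combining the two receivers. -/

section TwoReceivers

set_option linter.unusedSectionVars false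

variable {K₁ T₁ B₁ D₁ K₂ T₂ B₂ D₂ : Type*}
  [Fintype K₁] [DecidableEq K₁] [Fintype T₁] [DecidableEq T₁]
  [Fintype K₂] [DecidableEq K₂] [Fintype T₂] [DecidableEq T₂]
  [Fintype B₁] [DecidableEq B₁] [Fintype B₂] [DecidableEq B₂]
  [Fintype D₁] [DecidableEq D₁] [Fintype D₂] [DecidableEq D₂]

theorem localOp_eq_sum (U : Matrix (K₁ × T₁) (K₁ × T₁) ℂ) (V : Matrix (K₁ × D₁) (B₁ × T₁) ℂ)
    (a : K₁ × T₁ → B₁ → ℂ) (r : K₁) (p : K₁ × D₁) :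
    localOp U V a r p =
      ∑ x : (B₁ × T₁) × (K₁ × T₁), (V p x.1 * U (r, x.1.2) x.2) * a x.2 x.1.1 := by
  rw [Fintype.sum_prod_type]
  simp only [localOp, Finset.mul_sum, mul_assoc]

theorem localOp_comm (U₁ : Matrix (K₁ × T₁) (K₁ × T₁) ℂ) (V₁ : Matrix (K₁ × D₁) (B₁ × T₁) ℂ)
    (U₂ : Matrix (K₂ × T₂) (K₂ × T₂) ℂ) (V₂ : Matrix (K₂ × D₂) (B₂ × T₂) ℂ)
    (a : K₁ × T₁ → B₁ → K₂ × T₂ → B₂ → ℂ) (r₁ : K₁) (p₁ : K₁ × D₁) (r₂ : K₂) (p₂ : K₂ × D₂) :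
    localOp U₁ V₁ (fun j₁ b₁ => localOp U₂ V₂ (fun j₂ b₂ => a j₁ b₁ j₂ b₂) r₂ p₂) r₁ p₁ =
      localOp U₂ V₂ (fun j₂ b₂ => localOp U₁ V₁ (fun j₁ b₁ => a j₁ b₁ j₂ b₂) r₁ p₁) r₂ p₂ := by
  rw [localOp_eq_sum U₂ V₂]
  simp only [localOp_eq_sum U₂ V₂ (a _ _)]
  exact localOp_sum _ U₁ V₁ _ (fun (x : (B₂ × T₂) × (K₂ × T₂)) j₁ b₁ => a j₁ b₁ x.2 x.1.1) r₁ p₁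

theorem localOverlap_comm_localOp (U₁ : Matrix (K₁ × T₁) (K₁ × T₁) ℂ)
    (V₁ : Matrix (K₁ × D₁) (B₁ × T₁) ℂ) (U₂ : Matrix (K₂ × T₂) (K₂ × T₂) ℂ)
    (V₂ : Matrix (K₂ × D₂) (B₂ × T₂) ℂ) (a : K₁ × T₁ → B₁ → K₂ × T₂ → B₂ → ℂ)
    (d₁ : D₁) (r₂ : K₂) (p₂ : K₂ × D₂) :
    localOverlap U₁ V₁ (fun j₁ b₁ => localOp U₂ V₂ (fun j₂ b₂ => a j₁ b₁ j₂ b₂) r₂ p₂) d₁ =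
      localOp U₂ V₂ (fun j₂ b₂ => localOverlap U₁ V₁ (fun j₁ b₁ => a j₁ b₁ j₂ b₂) d₁) r₂ p₂ := by
  simp only [localOverlap, Finset.mul_sum]
  rw [localOp_sum]
  exact Finset.sum_congr rfl fun k _ => by rw [localOp_comm]

/-- The final amplitudes along both maximally entangled states. -/
def jointOverlap (U₁ : Matrix (K₁ × T₁) (K₁ × T₁) ℂ)
    (V₁ : Matrix (K₁ × D₁) (B₁ × T₁) ℂ) (U₂ : Matrix (K₂ × T₂) (K₂ × T₂) ℂ)
    (V₂ : Matrix (K₂ × D₂) (B₂ × T₂) ℂ) (a : K₁ × T₁ → B₁ → K₂ × T₂ → B₂ → ℂ)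
    (d₁ : D₁) (d₂ : D₂) : ℂ :=
  ∑ i : K₁ × K₁, conj (maxEnt K₁ i) * ∑ j : K₂ × K₂, conj (maxEnt K₂ j) *
    localOp U₁ V₁ (fun j₁ b₁ => localOp U₂ V₂ (fun j₂ b₂ => a j₁ b₁ j₂ b₂) j.1 (j.2, d₂))
      i.1 (i.2, d₁)

theorem sum_regroup {K D : Type*} [Fintype K] [Fintype D] (F : K → K × D → ℝ) :
    ∑ d, ∑ j : K × K, F j.1 (j.2, d) = ∑ r, ∑ p, F r p := by
  simp only [Fintype.sum_prod_type]
  rw [Finset.sum_comm]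
  exact Finset.sum_congr rfl fun r _ => Finset.sum_comm

theorem sum_swap_pairs {A B C D : Type*} [Fintype A] [Fintype B] [Fintype C] [Fintype D]
    (f : A → B → C → D → ℝ) :
    ∑ a, ∑ b, ∑ c, ∑ d, f a b c d = ∑ c, ∑ d, ∑ a, ∑ b, f a b c d := by
  rw [Finset.sum_congr rfl fun a _ => Finset.sum_comm, Finset.sum_comm]
  refine Finset.sum_congr rfl fun c _ => ?_
  rw [Finset.sum_congr rfl fun a _ => Finset.sum_comm, Finset.sum_comm]

theorem sum_norm_sq_localOp_localOp
    {U₁ : Matrix (K₁ × T₁) (K₁ × T₁) ℂ} (hU₁ : U₁ ∈ Matrix.unitaryGroup (K₁ × T₁) ℂ)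
    {V₁ : Matrix (K₁ × D₁) (B₁ × T₁) ℂ} (hV₁ : IsIsometry V₁)
    {U₂ : Matrix (K₂ × T₂) (K₂ × T₂) ℂ} (hU₂ : U₂ ∈ Matrix.unitaryGroup (K₂ × T₂) ℂ)
    {V₂ : Matrix (K₂ × D₂) (B₂ × T₂) ℂ} (hV₂ : IsIsometry V₂)
    (a : K₁ × T₁ → B₁ → K₂ × T₂ → B₂ → ℂ) :
    ∑ d₁, ∑ d₂, ∑ i : K₁ × K₁, ∑ j : K₂ × K₂, ‖localOp U₁ V₁ (fun j₁ b₁ =>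
        localOp U₂ V₂ (fun j₂ b₂ => a j₁ b₁ j₂ b₂) j.1 (j.2, d₂)) i.1 (i.2, d₁)‖ ^ 2 =
      ∑ j₁, ∑ b₁, ∑ j₂, ∑ b₂, ‖a j₁ b₁ j₂ b₂‖ ^ 2 := by
  have h : ∀ d₁ (i : K₁ × K₁), ∑ d₂, ∑ j : K₂ × K₂, ‖localOp U₁ V₁ (fun j₁ b₁ =>
      localOp U₂ V₂ (fun j₂ b₂ => a j₁ b₁ j₂ b₂) j.1 (j.2, d₂)) i.1 (i.2, d₁)‖ ^ 2 = ∑ j₂, ∑ b₂,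
      ‖localOp U₁ V₁ (fun j₁ b₁ => a j₁ b₁ j₂ b₂) i.1 (i.2, d₁)‖ ^ 2 := fun d₁ i => by
    rw [← sum_norm_sq_localOp hU₂ hV₂, ← sum_regroup]
    simp only [localOp_comm U₁ V₁ U₂ V₂]
  rw [Finset.sum_congr rfl fun d₁ _ => Finset.sum_comm]
  simp only [h]
  rw [sum_regroup fun r p => ∑ j₂, ∑ b₂, ‖localOp U₁ V₁ (fun j₁ b₁ => a j₁ b₁ j₂ b₂) r p‖ ^ 2]
  rw [sum_swap_pairs]
  simp only [sum_norm_sq_localOp hU₁ hV₁]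
  exact sum_swap_pairs fun j₂ b₂ j₁ b₁ => ‖a j₁ b₁ j₂ b₂‖ ^ 2

/-- The union bound is applied for each `d₁, d₂` and summed. In each single-receiver term the other
receiver's operation commutes past the overlap and drops out because it preserves norms. -/
theorem sum_norm_sq_jointOverlap_ge [Nonempty K₁] [Nonempty K₂]
    {U₁ : Matrix (K₁ × T₁) (K₁ × T₁) ℂ} (hU₁ : U₁ ∈ Matrix.unitaryGroup (K₁ × T₁) ℂ)
    {V₁ : Matrix (K₁ × D₁) (B₁ × T₁) ℂ} (hV₁ : IsIsometry V₁)
    {U₂ : Matrix (K₂ × T₂) (K₂ × T₂) ℂ} (hU₂ : U₂ ∈ Matrix.unitaryGroup (K₂ × T₂) ℂ)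
    {V₂ : Matrix (K₂ × D₂) (B₂ × T₂) ℂ} (hV₂ : IsIsometry V₂)
    (a : K₁ × T₁ → B₁ → K₂ × T₂ → B₂ → ℂ) :
    (∑ d₁, ∑ j₂, ∑ b₂, ‖localOverlap U₁ V₁ (fun j₁ b₁ => a j₁ b₁ j₂ b₂) d₁‖ ^ 2) +
        (∑ d₂, ∑ j₁, ∑ b₁, ‖localOverlap U₂ V₂ (fun j₂ b₂ => a j₁ b₁ j₂ b₂) d₂‖ ^ 2) -
        ∑ j₁, ∑ b₁, ∑ j₂, ∑ b₂, ‖a j₁ b₁ j₂ b₂‖ ^ 2 ≤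
      ∑ d₁, ∑ d₂, ‖jointOverlap U₁ V₁ U₂ V₂ a d₁ d₂‖ ^ 2 := by
  let m : D₁ → D₂ → K₁ × K₁ → K₂ × K₂ → ℂ := fun d₁ d₂ i j =>
    localOp U₁ V₁ (fun j₁ b₁ => localOp U₂ V₂ (fun j₂ b₂ => a j₁ b₁ j₂ b₂) j.1 (j.2, d₂))
      i.1 (i.2, d₁)
  have key := Finset.sum_le_sum fun d₁ (_ : d₁ ∈ Finset.univ) =>
    Finset.sum_le_sum fun d₂ (_ : d₂ ∈ Finset.univ) =>
      norm_sq_overlap_ge (sum_norm_sq_maxEnt K₁) (sum_norm_sq_maxEnt K₂) (m d₁ d₂)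
  simp only [Finset.sum_add_distrib, Finset.sum_sub_distrib] at key
  have e1 : ∑ d₁, ∑ d₂, ∑ j, ‖∑ i, conj (maxEnt K₁ i) * m d₁ d₂ i j‖ ^ 2 =
      ∑ d₁, ∑ j₂, ∑ b₂, ‖localOverlap U₁ V₁ (fun j₁ b₁ => a j₁ b₁ j₂ b₂) d₁‖ ^ 2 := by
    refine Finset.sum_congr rfl fun d₁ _ => ?_
    rw [← sum_norm_sq_localOp hU₂ hV₂, ← sum_regroup]
    simp only [m, sum_maxEnt_mul, ← localOverlap_comm_localOp]
    rfl
  have e2 : ∑ d₁, ∑ d₂, ∑ i, ‖∑ j, conj (maxEnt K₂ j) * m d₁ d₂ i j‖ ^ 2 =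
      ∑ d₂, ∑ j₁, ∑ b₁, ‖localOverlap U₂ V₂ (fun j₂ b₂ => a j₁ b₁ j₂ b₂) d₂‖ ^ 2 := by
    rw [Finset.sum_comm]
    refine Finset.sum_congr rfl fun d₂ _ => ?_
    rw [← sum_norm_sq_localOp hU₁ hV₁, ← sum_regroup]
    simp only [m, sum_maxEnt_mul, ← localOverlap_comm_localOp, localOp_comm U₁ V₁ U₂ V₂]
    rfl
  have e3 : ∑ d₁, ∑ d₂, ∑ i, ∑ j, ‖m d₁ d₂ i j‖ ^ 2 =
      ∑ j₁, ∑ b₁, ∑ j₂, ∑ b₂, ‖a j₁ b₁ j₂ b₂‖ ^ 2 :=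
    sum_norm_sq_localOp_localOp hU₁ hV₁ hU₂ hV₂ a
  rw [e1, e2, e3] at key
  exact key

end TwoReceivers

/-! ### The optimal state of the remaining systems. -/

section OptimalState

set_option linter.unusedSectionVars false

variable {I J Y : Type*} [Fintype I] [DecidableEq I] [Fintype J] [DecidableEq J]
  [Fintype Y] [DecidableEq Y]

theorem ketBra_kronecker (f : I → ℂ) (g : J → ℂ) :
    ketBra f ⊗ₖ ketBra g = ketBra fun p : I × J => f p.1 * g p.2 := by
  ext p q
  simp only [ketBra, Matrix.kroneckerMap_apply, Matrix.vecMulVec_apply, Pi.star_apply, star_mul']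
  ring

theorem norm_sq_dotProduct_le (x w : Y → ℂ) :
    ‖star x ⬝ᵥ w‖ ^ 2 ≤ (∑ i, ‖x i‖ ^ 2) * ∑ i, ‖w i‖ ^ 2 :=
  sum_norm_sq_mul_conj_le x w

/-- The distance from a pure state `w` to product states `(f ⊗ g) ⊗ χ` has a unique minimizer
among pure `χ`, provided that the component of `w` along `f ⊗ g` does not vanish. -/
theorem exists_unique_nearest_pure {f : I → ℂ} {g : J → ℂ} (hf : ∑ i, ‖f i‖ ^ 2 = 1)
    (hg : ∑ i, ‖g i‖ ^ 2 = 1) {w : (I × J) × Y → ℂ} (hw : ∑ i, ‖w i‖ ^ 2 = 1) {η : Y → ℂ}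
    (hη : ∀ y, η y = ∑ i, conj (f i) * ∑ j, conj (g j) * w ((i, j), y)) (h0 : η ≠ 0) :
    ∃ ψ : Matrix Y Y ℂ, IsPureState ψ ∧
      (∀ χ, IsPureState χ → χ ≠ ψ →
        traceNorm (ketBra w - (ketBra f ⊗ₖ ketBra g) ⊗ₖ ψ) <
          traceNorm (ketBra w - (ketBra f ⊗ₖ ketBra g) ⊗ₖ χ)) ∧
      traceNorm (ketBra w - (ketBra f ⊗ₖ ketBra g) ⊗ₖ ψ) = 2 * √(1 - ∑ y, ‖η y‖ ^ 2) := by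
  have hunit : ∀ x : Y → ℂ, ∑ y, ‖x y‖ ^ 2 = 1 →
      ∑ p : (I × J) × Y, ‖f p.1.1 * g p.1.2 * x p.2‖ ^ 2 = 1 := fun x hx => by
    simp only [norm_mul, mul_pow, Fintype.sum_prod_type, ← Finset.mul_sum, hx, mul_one, hg, hf]
  have hdot : ∀ x : Y → ℂ, star (fun p : (I × J) × Y => f p.1.1 * g p.1.2 * x p.2) ⬝ᵥ w =
      star x ⬝ᵥ η := fun x => by
    simp only [dotProduct, Pi.star_apply, star_mul', hη, Fintype.sum_prod_type, Finset.mul_sum,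
      Complex.star_def]
    rw [Finset.sum_congr rfl fun i _ => Finset.sum_comm, Finset.sum_comm]
    exact Finset.sum_congr rfl fun y _ => Finset.sum_congr rfl fun i _ =>
      Finset.sum_congr rfl fun j _ => by ring
  have hcs : ∀ x : Y → ℂ, ∑ y, ‖x y‖ ^ 2 = 1 → ‖star x ⬝ᵥ η‖ ^ 2 ≤ 1 := fun x hx => by
    have := norm_sq_dotProduct_le (fun p : (I × J) × Y => f p.1.1 * g p.1.2 * x p.2) w
    rwa [hdot, hunit x hx, hw, one_mul] at this
  have herr : ∀ x : Y → ℂ, ∑ y, ‖x y‖ ^ 2 = 1 →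
      traceNorm (ketBra w - (ketBra f ⊗ₖ ketBra g) ⊗ₖ ketBra x) =
        2 * √(1 - ‖star x ⬝ᵥ η‖ ^ 2) := fun x hx => by
    rw [ketBra_kronecker, ketBra_kronecker, traceNorm_ketBra_sub, hdot]
    · rw [dotProduct_star_self_eq, hw, Complex.ofReal_one]
    · rw [dotProduct_star_self_eq, hunit x hx, Complex.ofReal_one]
    · rw [hdot]; exact hcs x hx
  set s := ∑ y, ‖η y‖ ^ 2 with hs
  have hs0 : 0 < s := by
    obtain ⟨y, hy⟩ := Function.ne_iff.1 h0
    exact Finset.sum_pos' (fun _ _ => by positivity)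
      ⟨y, Finset.mem_univ _, by have : 0 < ‖η y‖ := norm_pos_iff.2 hy
                                positivity⟩
  have hss : √s * √s = s := Real.mul_self_sqrt hs0.le
  have hsq : 0 < √s := Real.sqrt_pos.2 hs0
  -- The error decreases with `|⟨x, η⟩|`, so the candidate is `η` normalized. Were `η` zero, all
  -- pure states would tie.
  let x₀ : Y → ℂ := fun y => (((√s)⁻¹ : ℝ) : ℂ) * η y
  have hx₀ : ∑ y, ‖x₀ y‖ ^ 2 = 1 := by
    simp only [x₀, norm_mul, mul_pow, ← Finset.mul_sum, ← hs, Complex.norm_real, Real.norm_eq_abs,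
      sq_abs]
    rw [inv_pow, Real.sq_sqrt hs0.le]
    field_simp
  have hdot₀ : star x₀ ⬝ᵥ η = ((√s : ℝ) : ℂ) := by
    have : star x₀ ⬝ᵥ η = (((√s)⁻¹ : ℝ) : ℂ) * (star η ⬝ᵥ η) := by
      simp only [dotProduct, x₀, Pi.star_apply, star_mul', Complex.star_def, Complex.conj_ofReal,
        Finset.mul_sum, mul_assoc]
    rw [this, dotProduct_star_self_eq, ← hs, ← Complex.ofReal_mul]
    congr 1
    nth_rewrite 2 [← hss]
    field_simp
  have hn₀ : ‖star x₀ ⬝ᵥ η‖ ^ 2 = s := by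
    rw [hdot₀, Complex.norm_real, Real.norm_eq_abs, sq_abs, Real.sq_sqrt hs0.le]
  refine ⟨ketBra x₀, ⟨x₀, by rw [dotProduct_star_self_eq, hx₀, Complex.ofReal_one], rfl⟩, ?_, ?_⟩
  · rintro χ ⟨x, hx, rfl⟩ hne
    have hx' : ∑ y, ‖x y‖ ^ 2 = 1 := by
      rw [dotProduct_star_self_eq] at hx; exact_mod_cast hx
    rw [herr _ hx₀, herr _ hx', hn₀]
    have hs1 : s ≤ 1 := hn₀ ▸ hcs x₀ hx₀
    refine mul_lt_mul_of_pos_left (Real.sqrt_lt_sqrt (by linarith) ?_) two_pos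
    by_contra hcon
    have hge : s ≤ ‖star x ⬝ᵥ η‖ ^ 2 := by linarith
    have hproj := sum_norm_sq_sub_proj hx' η
    change _ = s - ‖star x ⬝ᵥ η‖ ^ 2 at hproj
    -- Equality in Cauchy–Schwarz makes `η` a multiple of `x`; the remaining phase cancels in the
    -- density operator.
    have hzero : ∑ i, ‖η i - (star x ⬝ᵥ η) * x i‖ ^ 2 = 0 := by
      refine le_antisymm (hproj.trans_le (by linarith)) (Finset.sum_nonneg fun _ _ => by positivity)
    have hηx : ∀ i, η i = (star x ⬝ᵥ η) * x i := fun i => by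
      have := (Finset.sum_eq_zero_iff_of_nonneg fun _ _ => by positivity).1 hzero i
        (Finset.mem_univ _)
      exact sub_eq_zero.1 (norm_eq_zero.1 (pow_eq_zero_iff two_ne_zero |>.1 this))
    have hc : ‖star x ⬝ᵥ η‖ ^ 2 = s := by linarith [hproj.symm.trans hzero]
    apply hne
    ext i j
    simp only [ketBra, Matrix.vecMulVec_apply, Pi.star_apply, x₀, star_mul', Complex.star_def,
      Complex.conj_ofReal]
    rw [hηx i, hηx j, map_mul]
    have hcc : (star x ⬝ᵥ η) * conj (star x ⬝ᵥ η) = (s : ℂ) := by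
      rw [← norm_sq_eq_mul_conj, hc]
    have hinv : (((√s)⁻¹ : ℝ) : ℂ) * (((√s)⁻¹ : ℝ) : ℂ) * (s : ℂ) = 1 := by
      rw [← Complex.ofReal_mul, ← Complex.ofReal_mul, ← mul_inv, hss, inv_mul_cancel₀ hs0.ne',
        Complex.ofReal_one]
    linear_combination (-(x i * conj (x j))) * hinv -
      (x i * conj (x j)) * (((√s)⁻¹ : ℝ) : ℂ) * (((√s)⁻¹ : ℝ) : ℂ) * hcc
  · rw [herr _ hx₀, hn₀]

end OptimalState

/-! ### The transmitted state, the decoded state and the final estimate. -/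

section Protocol

set_option linter.unusedSectionVars false

variable {K₁ T₁ K₂ T₂ A' C B₁ B₂ E D₁ D₂ : Type*}
  [Fintype K₁] [DecidableEq K₁] [Fintype T₁] [DecidableEq T₁]
  [Fintype K₂] [DecidableEq K₂] [Fintype T₂] [DecidableEq T₂]
  [Fintype A'] [DecidableEq A'] [Fintype C] [DecidableEq C]
  [Fintype B₁] [DecidableEq B₁] [Fintype B₂] [DecidableEq B₂] [Fintype E] [DecidableEq E]
  [Fintype D₁] [DecidableEq D₁] [Fintype D₂] [DecidableEq D₂]

/-- The amplitudes of a transmitted state at fixed values of the systems `E Â`. -/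
def amplitudes (v : ((K₁ × T₁) × (K₂ × T₂)) × (((B₁ × B₂) × E) × C) → ℂ) (e : E) (c : C) :
    K₁ × T₁ → B₁ → K₂ × T₂ → B₂ → ℂ :=
  fun j₁ b₁ j₂ b₂ => v ((j₁, j₂), (((b₁, b₂), e), c))

/-- A transmitted state as seen by the first receiver. -/
def view₁ (v : ((K₁ × T₁) × (K₂ × T₂)) × (((B₁ × B₂) × E) × C) → ℂ) :
    K₁ × T₁ → K₂ × T₂ × B₂ × E × C → B₁ → ℂ :=
  fun i x b => v ((i, (x.1, x.2.1)), (((b, x.2.2.1), x.2.2.2.1), x.2.2.2.2))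

/-- A transmitted state as seen by the second receiver. -/
def view₂ (v : ((K₁ × T₁) × (K₂ × T₂)) × (((B₁ × B₂) × E) × C) → ℂ) :
    K₂ × T₂ → K₁ × T₁ × B₁ × E × C → B₂ → ℂ :=
  fun i x b => v (((x.1, x.2.1), i), (((x.2.2.1, b), x.2.2.2.1), x.2.2.2.2))

theorem frobSq_eq_purity {X : Type*} [Fintype X] {ρ : Matrix X X ℂ} (h : ρᴴ = ρ) :
    purity ρ = frobSq ρ := by
  rw [purity, ← Complex.ofReal_re (frobSq ρ), ofReal_frobSq, h]

theorem frobSq_blocks {I X : Type*} [Fintype I] [Fintype X] (ρ : Matrix (I × X) (I × X) ℂ) :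
    frobSq ρ = ∑ c : X × X, frobSq (Matrix.of fun i j => ρ (i, c.1) (j, c.2)) := by
  simp only [frobSq, Fintype.sum_prod_type, Matrix.of_apply]
  rw [Finset.sum_comm]
  refine Finset.sum_congr rfl fun x _ => ?_
  rw [Finset.sum_congr rfl fun i _ => Finset.sum_comm, Finset.sum_comm]

theorem purity_reduced₁ (v : ((K₁ × T₁) × (K₂ × T₂)) × (((B₁ × B₂) × E) × C) → ℂ) :
    purity (reduced₁ v) =
      ∑ c : (K₂ × T₂ × B₂ × E × C) × (K₂ × T₂ × B₂ × E × C), frobSq (reducedBlock (view₁ v) c.1 c.2) := by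
  rw [frobSq_eq_purity, frobSq_blocks]
  · rfl
  · ext p q
    simp only [reduced₁, partialTrace, Matrix.conjTranspose_apply, Matrix.of_apply, ketBra,
      Matrix.vecMulVec_apply, star_sum, star_mul', Pi.star_apply, star_star]
    exact Finset.sum_congr rfl fun _ _ => mul_comm _ _

theorem purity_reduced₂ (v : ((K₁ × T₁) × (K₂ × T₂)) × (((B₁ × B₂) × E) × C) → ℂ) :
    purity (reduced₂ v) =
      ∑ c : (K₁ × T₁ × B₁ × E × C) × (K₁ × T₁ × B₁ × E × C), frobSq (reducedBlock (view₂ v) c.1 c.2) := by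
  rw [frobSq_eq_purity, frobSq_blocks]
  · rfl
  · ext p q
    simp only [reduced₂, partialTrace, Matrix.conjTranspose_apply, Matrix.of_apply, ketBra,
      Matrix.vecMulVec_apply, star_sum, star_mul', Pi.star_apply, star_star]
    exact Finset.sum_congr rfl fun _ _ => mul_comm _ _

/-- The common value of the nonzero coefficients of the input state. -/
def inputCoeff (K₁ T₁ K₂ T₂ : Type*) [Fintype K₁] [Fintype T₁] [Fintype K₂] [Fintype T₂] : ℂ :=
  ((1 / √(Fintype.card K₁ : ℝ) : ℝ) : ℂ) * ((1 / √(Fintype.card T₁ : ℝ) : ℝ) : ℂ) *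
    ((1 / √(Fintype.card K₂ : ℝ) : ℝ) : ℂ) * ((1 / √(Fintype.card T₂ : ℝ) : ℝ) : ℂ)

theorem inputState_apply (p q : (K₁ × T₁) × (K₂ × T₂)) :
    inputState K₁ T₁ K₂ T₂ (p, q) = if p = q then inputCoeff K₁ T₁ K₂ T₂ else 0 := by
  obtain ⟨⟨r₁, b₁⟩, ⟨r₂, b₂⟩⟩ := p
  obtain ⟨⟨a₁, t₁⟩, ⟨a₂, t₂⟩⟩ := q
  simp only [inputState, maxEnt, inputCoeff, Prod.mk.injEq]
  by_cases h1 : r₁ = a₁ <;> by_cases h2 : b₁ = t₁ <;> by_cases h3 : r₂ = a₂ <;>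
    by_cases h4 : b₂ = t₂ <;> simp [h1, h2, h3, h4, eq_comm]

theorem transmitted_apply (U : Matrix ((B₁ × B₂) × E) A' ℂ)
    (W : Matrix (A' × C) ((K₁ × T₁) × (K₂ × T₂)) ℂ)
    (G : Matrix ((K₁ × T₁) × (K₂ × T₂)) ((K₁ × T₁) × (K₂ × T₂)) ℂ)
    (p : (K₁ × T₁) × (K₂ × T₂)) (s : ((B₁ × B₂) × E) × C) :
    transmitted U W G (p, s) =
      ((U ⊗ₖ (1 : Matrix C C ℂ)) * W * G) s p * inputCoeff K₁ T₁ K₂ T₂ := by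
  rw [transmitted, Matrix.mulVec, dotProduct, Fintype.sum_prod_type, Finset.sum_eq_single p]
  · simp [inputState_apply]
  · intro p' _ h; simp [Matrix.one_apply_ne h.symm]
  · simp

/-- The transpose trick. -/
theorem transmitted_transpose (U : Matrix ((B₁ × B₂) × E) A' ℂ)
    (W : Matrix (A' × C) ((K₁ × T₁) × (K₂ × T₂)) ℂ) (U₁ : Matrix (K₁ × T₁) (K₁ × T₁) ℂ)
    (U₂ : Matrix (K₂ × T₂) (K₂ × T₂) ℂ) (i : K₁ × T₁) (j : K₂ × T₂)
    (s : ((B₁ × B₂) × E) × C) :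
    transmitted U W (U₁ᵀ ⊗ₖ U₂ᵀ) ((i, j), s) =
      ∑ i', U₁ i i' * ∑ j', U₂ j j' * transmitted U W 1 ((i', j'), s) := by
  simp only [transmitted_apply, Matrix.mul_one]
  rw [Matrix.mul_apply, Fintype.sum_prod_type, Finset.sum_mul]
  refine Finset.sum_congr rfl fun i' _ => ?_
  rw [Finset.sum_mul, Finset.mul_sum]
  refine Finset.sum_congr rfl fun j' _ => ?_
  simp only [Matrix.kroneckerMap_apply, Matrix.transpose_apply]
  ring

theorem decoded_eq_localOp (U : Matrix ((B₁ × B₂) × E) A' ℂ)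
    (W : Matrix (A' × C) ((K₁ × T₁) × (K₂ × T₂)) ℂ) (U₁ : Matrix (K₁ × T₁) (K₁ × T₁) ℂ)
    (U₂ : Matrix (K₂ × T₂) (K₂ × T₂) ℂ) (V₁ : Matrix (K₁ × D₁) (B₁ × T₁) ℂ)
    (V₂ : Matrix (K₂ × D₂) (B₂ × T₂) ℂ) (i : K₁ × K₁) (j : K₂ × K₂) (d₁ : D₁) (d₂ : D₂) (e : E)
    (c : C) :
    decoded V₁ V₂ (transmitted U W (U₁ᵀ ⊗ₖ U₂ᵀ)) ((i, j), (d₁, d₂, e, c)) =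
      localOp U₁ V₁ (fun j₁ b₁ => localOp U₂ V₂
        (fun j₂ b₂ => amplitudes (transmitted U W 1) e c j₁ b₁ j₂ b₂) j.1 (j.2, d₂))
        i.1 (i.2, d₁) := by
  simp only [decoded, Matrix.mulVec, dotProduct, Fintype.sum_prod_type (α₁ := B₁ × T₁),
    transmitted_transpose, Matrix.kroneckerMap_apply]
  rw [localOp]
  refine Finset.sum_congr rfl fun q₁ _ => ?_
  simp only [localOp, mul_assoc, ← Finset.mul_sum]
  congr 1
  simp only [Finset.mul_sum]
  rw [Finset.sum_comm]
  refine Finset.sum_congr rfl fun j₁ _ => Finset.sum_congr rfl fun q₂ _ =>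
    Finset.sum_congr rfl fun j₂ _ => ?_
  simp only [amplitudes]
  ring

theorem sum_norm_sq_transmitted [Nonempty K₁] [Nonempty T₁] [Nonempty K₂] [Nonempty T₂]
    {U : Matrix ((B₁ × B₂) × E) A' ℂ} (hU : IsIsometry U)
    {W : Matrix (A' × C) ((K₁ × T₁) × (K₂ × T₂)) ℂ} (hW : IsIsometry W) :
    ∑ i, ‖transmitted U W 1 i‖ ^ 2 = 1 := by
  have hM : ((U ⊗ₖ (1 : Matrix C C ℂ)) * W)ᴴ * ((U ⊗ₖ (1 : Matrix C C ℂ)) * W) = 1 := by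
    rw [Matrix.conjTranspose_mul, Matrix.mul_assoc, ← Matrix.mul_assoc _ _ W,
      Matrix.conjTranspose_kronecker, ← Matrix.mul_kronecker_mul, hU, Matrix.conjTranspose_one,
      Matrix.mul_one, Matrix.one_kronecker_one, Matrix.one_mul, hW]
  have hcol : ∀ p, ∑ s, ‖((U ⊗ₖ (1 : Matrix C C ℂ)) * W) s p‖ ^ 2 = 1 := fun p => by
    apply Complex.ofReal_injective
    have := congrFun (congrFun hM p) p
    rw [Matrix.one_apply_eq] at this
    rw [← dotProduct_star_self_eq, Complex.ofReal_one, ← this]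
    rfl
  have hc : ‖inputCoeff K₁ T₁ K₂ T₂‖ ^ 2 = 1 / (Fintype.card ((K₁ × T₁) × (K₂ × T₂)) : ℝ) := by
    simp only [inputCoeff, norm_mul, mul_pow, Complex.norm_real, Real.norm_eq_abs, sq_abs, div_pow,
      one_pow, Real.sq_sqrt (Nat.cast_nonneg _), Fintype.card_prod, Nat.cast_mul]
    field_simp
  have hn : (Fintype.card ((K₁ × T₁) × (K₂ × T₂)) : ℝ) ≠ 0 := by
    exact_mod_cast Fintype.card_ne_zero
  simp only [Fintype.sum_prod_type (α₁ := (K₁ × T₁) × (K₂ × T₂)), transmitted_apply,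
    Matrix.mul_one, norm_mul, mul_pow, ← Finset.sum_mul, hcol, hc, Finset.sum_const,
    Finset.card_univ, nsmul_eq_mul]
  field_simp

theorem sum_norm_sq_amplitudes (v : ((K₁ × T₁) × (K₂ × T₂)) × (((B₁ × B₂) × E) × C) → ℂ) :
    ∑ e, ∑ c, ∑ j₁, ∑ b₁, ∑ j₂, ∑ b₂, ‖amplitudes v e c j₁ b₁ j₂ b₂‖ ^ 2 = ∑ i, ‖v i‖ ^ 2 := by
  simp only [← Fintype.sum_prod_type']
  let f : E × C × (K₁ × T₁) × B₁ × (K₂ × T₂) × B₂ ≃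
      ((K₁ × T₁) × (K₂ × T₂)) × (((B₁ × B₂) × E) × C) :=
    ⟨fun ⟨e, c, j₁, b₁, j₂, b₂⟩ => ((j₁, j₂), (((b₁, b₂), e), c)),
      fun ⟨⟨j₁, j₂⟩, ⟨⟨b₁, b₂⟩, e⟩, c⟩ => (e, c, j₁, b₁, j₂, b₂), fun _ => rfl, fun _ => rfl⟩
  exact Fintype.sum_equiv f _ _ fun _ => rfl

theorem sum_norm_sq_decoded {U : Matrix ((B₁ × B₂) × E) A' ℂ}
    {W : Matrix (A' × C) ((K₁ × T₁) × (K₂ × T₂)) ℂ}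
    {U₁ : Matrix (K₁ × T₁) (K₁ × T₁) ℂ} (hU₁ : U₁ ∈ Matrix.unitaryGroup (K₁ × T₁) ℂ)
    {V₁ : Matrix (K₁ × D₁) (B₁ × T₁) ℂ} (hV₁ : IsIsometry V₁)
    {U₂ : Matrix (K₂ × T₂) (K₂ × T₂) ℂ} (hU₂ : U₂ ∈ Matrix.unitaryGroup (K₂ × T₂) ℂ)
    {V₂ : Matrix (K₂ × D₂) (B₂ × T₂) ℂ} (hV₂ : IsIsometry V₂) :
    ∑ i, ‖decoded V₁ V₂ (transmitted U W (U₁ᵀ ⊗ₖ U₂ᵀ)) i‖ ^ 2 =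
      ∑ i, ‖transmitted U W 1 i‖ ^ 2 := by
  rw [← sum_norm_sq_amplitudes]
  simp only [← sum_norm_sq_localOp_localOp hU₁ hV₁ hU₂ hV₂, ← decoded_eq_localOp]
  simp only [← Fintype.sum_prod_type' (α₁ := E), ← Fintype.sum_prod_type' (α₁ := C),
    ← Fintype.sum_prod_type' (α₁ := D₁), ← Fintype.sum_prod_type' (α₁ := D₂),
    ← Fintype.sum_prod_type' (α₁ := K₁ × K₁)]
  let f : E × C × D₁ × D₂ × (K₁ × K₁) × (K₂ × K₂) ≃
      ((K₁ × K₁) × (K₂ × K₂)) × (D₁ × D₂ × E × C) :=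
    ⟨fun ⟨e, c, d₁, d₂, i, j⟩ => ((i, j), (d₁, d₂, e, c)),
      fun ⟨⟨i, j⟩, d₁, d₂, e, c⟩ => (e, c, d₁, d₂, i, j), fun _ => rfl, fun _ => rfl⟩
  exact (Fintype.sum_equiv f _ _ fun _ => rfl).symm

/-- Every protocol whose final state is not orthogonal to the target has a unique optimal state
of the remaining systems. -/
theorem exists_optimal_state [Nonempty K₁] [Nonempty T₁] [Nonempty K₂] [Nonempty T₂]
    {U : Matrix ((B₁ × B₂) × E) A' ℂ} (hU : IsIsometry U)
    {W : Matrix (A' × C) ((K₁ × T₁) × (K₂ × T₂)) ℂ} (hW : IsIsometry W)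
    {U₁ : Matrix (K₁ × T₁) (K₁ × T₁) ℂ} (hU₁ : U₁ ∈ Matrix.unitaryGroup (K₁ × T₁) ℂ)
    {V₁ : Matrix (K₁ × D₁) (B₁ × T₁) ℂ} (hV₁ : IsIsometry V₁)
    {U₂ : Matrix (K₂ × T₂) (K₂ × T₂) ℂ} (hU₂ : U₂ ∈ Matrix.unitaryGroup (K₂ × T₂) ℂ)
    {V₂ : Matrix (K₂ × D₂) (B₂ × T₂) ℂ} (hV₂ : IsIsometry V₂)
    (h0 : ∃ d₁ d₂ e c,
      jointOverlap U₁ V₁ U₂ V₂ (amplitudes (transmitted U W 1) e c) d₁ d₂ ≠ 0) :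
    ∃ ψ : Matrix (D₁ × D₂ × E × C) (D₁ × D₂ × E × C) ℂ, IsPureState ψ ∧
      (∀ χ, IsPureState χ → χ ≠ ψ →
        protocolError U W U₁ U₂ V₁ V₂ ψ < protocolError U W U₁ U₂ V₁ V₂ χ) ∧
      protocolError U W U₁ U₂ V₁ V₂ ψ = 2 * √(1 - ∑ e, ∑ c, ∑ d₁, ∑ d₂,
        ‖jointOverlap U₁ V₁ U₂ V₂ (amplitudes (transmitted U W 1) e c) d₁ d₂‖ ^ 2) := by
  let η : D₁ × D₂ × E × C → ℂ := fun y =>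
    jointOverlap U₁ V₁ U₂ V₂ (amplitudes (transmitted U W 1) y.2.2.1 y.2.2.2) y.1 y.2.1
  have hη : ∑ y, ‖η y‖ ^ 2 = ∑ e, ∑ c, ∑ d₁, ∑ d₂,
      ‖jointOverlap U₁ V₁ U₂ V₂ (amplitudes (transmitted U W 1) e c) d₁ d₂‖ ^ 2 := by
    simp only [Fintype.sum_prod_type, η]
    exact sum_swap_pairs fun d₁ d₂ e c =>
      ‖jointOverlap U₁ V₁ U₂ V₂ (amplitudes (transmitted U W 1) e c) d₁ d₂‖ ^ 2
  have hw : ∑ i, ‖decoded V₁ V₂ (transmitted U W (U₁ᵀ ⊗ₖ U₂ᵀ)) i‖ ^ 2 = 1 :=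
    (sum_norm_sq_decoded hU₁ hV₁ hU₂ hV₂).trans (sum_norm_sq_transmitted hU hW)
  rw [← hη]
  refine exists_unique_nearest_pure (sum_norm_sq_maxEnt K₁) (sum_norm_sq_maxEnt K₂) hw
    (fun y => ?_) ?_
  · obtain ⟨d₁, d₂, e, c⟩ := y
    simp only [η, jointOverlap, decoded_eq_localOp]
  · obtain ⟨d₁, d₂, e, c, h⟩ := h0
    exact Function.ne_iff.2 ⟨(d₁, d₂, e, c), h⟩

theorem isIsometry_of_injective {X Y : Type*} [Fintype X] [DecidableEq X] [Fintype Y]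
    [DecidableEq Y] {f : X → Y} (hf : Function.Injective f) :
    IsIsometry (Matrix.of fun p q => if p = f q then (1 : ℂ) else 0) := by
  ext q q'
  simp only [Matrix.mul_apply, Matrix.conjTranspose_apply, Matrix.of_apply, Matrix.one_apply]
  simp [apply_ite star, hf.eq_iff, eq_comm]

/-- Some protocol has a final state that is not orthogonal to the target. -/
theorem exists_jointOverlap_ne_zero [Nonempty K₁] [Nonempty K₂]
    {v : ((K₁ × T₁) × (K₂ × T₂)) × (((B₁ × B₂) × E) × C) → ℂ} (hv : ∑ i, ‖v i‖ ^ 2 = 1) :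
    ∃ (n₁ n₂ : ℕ) (V₁ : Matrix (K₁ × Fin n₁) (B₁ × T₁) ℂ) (V₂ : Matrix (K₂ × Fin n₂) (B₂ × T₂) ℂ),
      IsIsometry V₁ ∧ IsIsometry V₂ ∧
      ∃ d₁ d₂ e c, jointOverlap 1 V₁ 1 V₂ (amplitudes v e c) d₁ d₂ ≠ 0 := by
  obtain ⟨⟨⟨⟨r₁, t₁⟩, ⟨r₂, t₂⟩⟩, ⟨⟨⟨b₁, b₂⟩, e⟩, c⟩⟩, hne⟩ : ∃ i, v i ≠ 0 := by
    by_contra! h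
    simp [h] at hv
  let e₁ := Fintype.equivFin (B₁ × T₁)
  let e₂ := Fintype.equivFin (B₂ × T₂)
  -- The decoder stores its whole input in `B̂₁` and prepares the basis state `r₁` in `B̄₁`, where
  -- `r₁` comes from a nonzero amplitude of `v`. At the matching outcome labels, the overlap is that
  -- amplitude times normalization constants.
  let V₁ : Matrix (K₁ × Fin _) (B₁ × T₁) ℂ := Matrix.of fun p q =>
    if p = (r₁, e₁ q) then (1 : ℂ) else 0
  let V₂ : Matrix (K₂ × Fin _) (B₂ × T₂) ℂ := Matrix.of fun p q =>
    if p = (r₂, e₂ q) then (1 : ℂ) else 0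
  have h1 : ∀ (a : K₁ × T₁ → B₁ → ℂ) r k, localOp 1 V₁ a r (k, e₁ (b₁, t₁)) =
      if k = r₁ then a (r, t₁) b₁ else 0 := fun a r k => by
    rw [localOp_one, Finset.sum_eq_single (b₁, t₁)]
    · simp [V₁]
    · intro q _ hq
      simp [V₁, Ne.symm hq]
    · simp
  have h2 : ∀ (a : K₂ × T₂ → B₂ → ℂ) r k, localOp 1 V₂ a r (k, e₂ (b₂, t₂)) =
      if k = r₂ then a (r, t₂) b₂ else 0 := fun a r k => by
    rw [localOp_one, Finset.sum_eq_single (b₂, t₂)]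
    · simp [V₂]
    · intro q _ hq
      simp [V₂, Ne.symm hq]
    · simp
  refine ⟨_, _, V₁, V₂, isIsometry_of_injective (f := fun q => (r₁, e₁ q)) ?_,
    isIsometry_of_injective (f := fun q => (r₂, e₂ q)) ?_, e₁ (b₁, t₁), e₂ (b₂, t₂), e, c, ?_⟩
  · intro q q' h; exact e₁.injective (Prod.mk.inj h).2
  · intro q q' h; exact e₂.injective (Prod.mk.inj h).2
  · have hK₁ : ((1 / √(Fintype.card K₁ : ℝ) : ℝ) : ℂ) ≠ 0 := by
      rw [Complex.ofReal_ne_zero]; positivity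
    have hK₂ : ((1 / √(Fintype.card K₂ : ℝ) : ℝ) : ℂ) ≠ 0 := by
      rw [Complex.ofReal_ne_zero]; positivity
    have : jointOverlap 1 V₁ 1 V₂ (amplitudes v e c) (e₁ (b₁, t₁)) (e₂ (b₂, t₂)) =
        ((1 / √(Fintype.card K₁ : ℝ) : ℝ) : ℂ) * (((1 / √(Fintype.card K₂ : ℝ) : ℝ) : ℂ) *
          v (((r₁, t₁), (r₂, t₂)), (((b₁, b₂), e), c))) := by
      simp only [jointOverlap, h1, h2, sum_maxEnt_mul, amplitudes]
      simp
    rw [this]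
    exact mul_ne_zero hK₁ (mul_ne_zero hK₂ hne)

theorem sum_norm_sq_jointOverlap_add_one_ge [Nonempty K₁] [Nonempty K₂]
    {U₁ : Matrix (K₁ × T₁) (K₁ × T₁) ℂ} (hU₁ : U₁ ∈ Matrix.unitaryGroup (K₁ × T₁) ℂ)
    {V₁ : Matrix (K₁ × D₁) (B₁ × T₁) ℂ} (hV₁ : IsIsometry V₁)
    {U₂ : Matrix (K₂ × T₂) (K₂ × T₂) ℂ} (hU₂ : U₂ ∈ Matrix.unitaryGroup (K₂ × T₂) ℂ)
    {V₂ : Matrix (K₂ × D₂) (B₂ × T₂) ℂ} (hV₂ : IsIsometry V₂)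
    {v : ((K₁ × T₁) × (K₂ × T₂)) × (((B₁ × B₂) × E) × C) → ℂ} (hv : ∑ i, ‖v i‖ ^ 2 = 1) :
    (∑ d, ∑ x, ‖overlap V₁ (actOn U₁ (view₁ v)) d x‖ ^ 2) +
        (∑ d, ∑ x, ‖overlap V₂ (actOn U₂ (view₂ v)) d x‖ ^ 2) ≤
      (∑ e, ∑ c, ∑ d₁, ∑ d₂, ‖jointOverlap U₁ V₁ U₂ V₂ (amplitudes v e c) d₁ d₂‖ ^ 2) + 1 := by
  have key := Finset.sum_le_sum fun e (_ : e ∈ (Finset.univ : Finset E)) =>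
    Finset.sum_le_sum fun c (_ : c ∈ (Finset.univ : Finset C)) =>
      sum_norm_sq_jointOverlap_ge hU₁ hV₁ hU₂ hV₂ (amplitudes v e c)
  simp only [Finset.sum_add_distrib, Finset.sum_sub_distrib] at key
  have e1 : ∑ e, ∑ c, ∑ d₁, ∑ j₂, ∑ b₂,
      ‖localOverlap U₁ V₁ (fun j₁ b₁ => amplitudes v e c j₁ b₁ j₂ b₂) d₁‖ ^ 2 =
      ∑ d, ∑ x, ‖overlap V₁ (actOn U₁ (view₁ v)) d x‖ ^ 2 := by
    simp only [← Fintype.sum_prod_type']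
    let f : E × C × D₁ × (K₂ × T₂) × B₂ ≃ D₁ × K₂ × T₂ × B₂ × E × C :=
      ⟨fun ⟨e, c, d₁, ⟨r₂, t₂⟩, b₂⟩ => (d₁, r₂, t₂, b₂, e, c),
        fun ⟨d₁, r₂, t₂, b₂, e, c⟩ => (e, c, d₁, (r₂, t₂), b₂), fun _ => rfl, fun _ => rfl⟩
    exact Fintype.sum_equiv f _ _ fun _ => rfl
  have e2 : ∑ e, ∑ c, ∑ d₂, ∑ j₁, ∑ b₁,
      ‖localOverlap U₂ V₂ (fun j₂ b₂ => amplitudes v e c j₁ b₁ j₂ b₂) d₂‖ ^ 2 =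
      ∑ d, ∑ x, ‖overlap V₂ (actOn U₂ (view₂ v)) d x‖ ^ 2 := by
    simp only [← Fintype.sum_prod_type']
    let f : E × C × D₂ × (K₁ × T₁) × B₁ ≃ D₂ × K₁ × T₁ × B₁ × E × C :=
      ⟨fun ⟨e, c, d₂, ⟨r₁, t₁⟩, b₁⟩ => (d₂, r₁, t₁, b₁, e, c),
        fun ⟨d₂, r₁, t₁, b₁, e, c⟩ => (e, c, d₂, (r₁, t₁), b₁), fun _ => rfl, fun _ => rfl⟩
    exact Fintype.sum_equiv f _ _ fun _ => rfl
  have e3 : ∑ e, ∑ c, ∑ j₁, ∑ b₁, ∑ j₂, ∑ b₂, ‖amplitudes v e c j₁ b₁ j₂ b₂‖ ^ 2 = 1 :=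
    (sum_norm_sq_amplitudes v).trans hv
  rw [e1, e2, e3] at key
  linarith

theorem sum_norm_sq_view₁ (v : ((K₁ × T₁) × (K₂ × T₂)) × (((B₁ × B₂) × E) × C) → ℂ) :
    ∑ i, ∑ x, ∑ b, ‖view₁ v i x b‖ ^ 2 = ∑ i, ‖v i‖ ^ 2 := by
  simp only [← Fintype.sum_prod_type']
  let f : (K₁ × T₁) × (K₂ × T₂ × B₂ × E × C) × B₁ ≃
      ((K₁ × T₁) × (K₂ × T₂)) × (((B₁ × B₂) × E) × C) :=
    ⟨fun ⟨i, ⟨r, t, b₂, e, c⟩, b₁⟩ => ((i, (r, t)), (((b₁, b₂), e), c)),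
      fun ⟨⟨i, r, t⟩, ⟨⟨b₁, b₂⟩, e⟩, c⟩ => (i, (r, t, b₂, e, c), b₁), fun _ => rfl, fun _ => rfl⟩
  exact Fintype.sum_equiv f _ _ fun _ => rfl

theorem sum_norm_sq_view₂ (v : ((K₁ × T₁) × (K₂ × T₂)) × (((B₁ × B₂) × E) × C) → ℂ) :
    ∑ i, ∑ x, ∑ b, ‖view₂ v i x b‖ ^ 2 = ∑ i, ‖v i‖ ^ 2 := by
  simp only [← Fintype.sum_prod_type']
  let f : (K₂ × T₂) × (K₁ × T₁ × B₁ × E × C) × B₂ ≃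
      ((K₁ × T₁) × (K₂ × T₂)) × (((B₁ × B₂) × E) × C) :=
    ⟨fun ⟨j, ⟨r, t, b₁, e, c⟩, b₂⟩ => (((r, t), j), (((b₁, b₂), e), c)),
      fun ⟨⟨⟨r, t⟩, j⟩, ⟨⟨b₁, b₂⟩, e⟩, c⟩ => (j, (r, t, b₁, e, c), b₂), fun _ => rfl, fun _ => rfl⟩
  exact Fintype.sum_equiv f _ _ fun _ => rfl

end Protocol

end BroadcastFather

end

theorem theorem1 {K₁ T₁ K₂ T₂ A' C B₁ B₂ E : Type*}
    [Fintype K₁] [DecidableEq K₁] [Nonempty K₁] [Fintype T₁] [DecidableEq T₁] [Nonempty T₁]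
    [Fintype K₂] [DecidableEq K₂] [Nonempty K₂] [Fintype T₂] [DecidableEq T₂] [Nonempty T₂]
    [Fintype A'] [DecidableEq A'] [Fintype C] [DecidableEq C]
    [Fintype B₁] [DecidableEq B₁] [Fintype B₂] [DecidableEq B₂] [Fintype E] [DecidableEq E]
    (N : Matrix A' A' ℂ →ₗ[ℂ] Matrix (B₁ × B₂) (B₁ × B₂) ℂ)
    (hN : BroadcastFather.IsQuantumChannel N)
    (U_N : Matrix ((B₁ × B₂) × E) A' ℂ) (hU_N : BroadcastFather.IsIsometricExtension N U_N)
    (W : Matrix (A' × C) ((K₁ × T₁) × (K₂ × T₂)) ℂ) (hW : BroadcastFather.IsIsometry W) :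
    ∃ U₁ ∈ Matrix.unitaryGroup (K₁ × T₁) ℂ, ∃ U₂ ∈ Matrix.unitaryGroup (K₂ × T₂) ℂ,
    ∃ (d₁ d₂ : ℕ)
      (V₁ : Matrix (K₁ × Fin d₁) (B₁ × T₁) ℂ) (V₂ : Matrix (K₂ × Fin d₂) (B₂ × T₂) ℂ),
      BroadcastFather.IsIsometry V₁ ∧ BroadcastFather.IsIsometry V₂ ∧
      ∃ ψhat : Matrix (Fin d₁ × Fin d₂ × E × C) (Fin d₁ × Fin d₂ × E × C) ℂ,
        BroadcastFather.IsPureState ψhat ∧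
        (∀ χ, BroadcastFather.IsPureState χ → χ ≠ ψhat →
          BroadcastFather.protocolError U_N W U₁ U₂ V₁ V₂ ψhat <
            BroadcastFather.protocolError U_N W U₁ U₂ V₁ V₂ χ) ∧
        BroadcastFather.protocolError U_N W U₁ U₂ V₁ V₂ ψhat ≤
          4 * ((Fintype.card K₁ : ℝ) * (Fintype.card T₁ : ℝ) *
                (Fintype.card (K₂ × T₂ × B₂ × E × C) : ℝ) / (Fintype.card T₁ : ℝ) ^ 2 *
              BroadcastFather.purity
                (BroadcastFather.reduced₁ (BroadcastFather.transmitted U_N W 1))) ^ (1 / 4 : ℝ) +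
          2 * ((Fintype.card K₂ : ℝ) * (Fintype.card T₂ : ℝ) *
                (Fintype.card (K₁ × T₁ × B₁ × E × C) : ℝ) / (Fintype.card T₂ : ℝ) ^ 2 *
              BroadcastFather.purity
                (BroadcastFather.reduced₂ (BroadcastFather.transmitted U_N W 1))) ^ (1 / 4 : ℝ) := by
  set v := BroadcastFather.transmitted U_N W 1 with hv
  have hv1 : ∑ i, ‖v i‖ ^ 2 = 1 := BroadcastFather.sum_norm_sq_transmitted hU_N.1 hW
  obtain ⟨U₁, hU₁, d₁, V₁, hV₁, hb₁⟩ := BroadcastFather.exists_unitary_isometry_overlap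
    (BroadcastFather.view₁ v) ((BroadcastFather.sum_norm_sq_view₁ v).trans hv1)
  obtain ⟨U₂, hU₂, d₂, V₂, hV₂, hb₂⟩ := BroadcastFather.exists_unitary_isometry_overlap
    (BroadcastFather.view₂ v) ((BroadcastFather.sum_norm_sq_view₂ v).trans hv1)
  have hjoint := BroadcastFather.sum_norm_sq_jointOverlap_add_one_ge hU₁ hV₁ hU₂ hV₂ hv1
  rw [← BroadcastFather.purity_reduced₁] at hb₁
  rw [← BroadcastFather.purity_reduced₂] at hb₂
  have hp₁ : 0 ≤ BroadcastFather.purity (BroadcastFather.reduced₁ v) := by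
    rw [BroadcastFather.purity_reduced₁]
    exact Finset.sum_nonneg fun _ _ => BroadcastFather.frobSq_nonneg _
  have hp₂ : 0 ≤ BroadcastFather.purity (BroadcastFather.reduced₂ v) := by
    rw [BroadcastFather.purity_reduced₂]
    exact Finset.sum_nonneg fun _ _ => BroadcastFather.frobSq_nonneg _
  have hT₁ : (Fintype.card T₁ : ℝ) ≠ 0 := by exact_mod_cast Fintype.card_ne_zero
  have hT₂ : (Fintype.card T₂ : ℝ) ≠ 0 := by exact_mod_cast Fintype.card_ne_zero
  set Δ₁ : ℝ := (Fintype.card K₁ : ℝ) * (Fintype.card T₁ : ℝ) *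
    (Fintype.card (K₂ × T₂ × B₂ × E × C) : ℝ) / (Fintype.card T₁ : ℝ) ^ 2 *
      BroadcastFather.purity (BroadcastFather.reduced₁ v) with hΔ₁
  set Δ₂ : ℝ := (Fintype.card K₂ : ℝ) * (Fintype.card T₂ : ℝ) *
    (Fintype.card (K₁ × T₁ × B₁ × E × C) : ℝ) / (Fintype.card T₂ : ℝ) ^ 2 *
      BroadcastFather.purity (BroadcastFather.reduced₂ v) with hΔ₂
  have hΔ₁0 : 0 ≤ Δ₁ := by positivity
  have hΔ₂0 : 0 ≤ Δ₂ := by positivity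
  rw [show (Fintype.card K₁ : ℝ) * (Fintype.card (K₂ × T₂ × B₂ × E × C) : ℝ) *
    BroadcastFather.purity (BroadcastFather.reduced₁ v) / Fintype.card T₁ = Δ₁ by
      rw [hΔ₁]; field_simp] at hb₁
  rw [show (Fintype.card K₂ : ℝ) * (Fintype.card (K₁ × T₁ × B₁ × E × C) : ℝ) *
    BroadcastFather.purity (BroadcastFather.reduced₂ v) / Fintype.card T₂ = Δ₂ by
      rw [hΔ₂]; field_simp] at hb₂
  have hroot : ∀ x : ℝ, 0 ≤ x → √x = (x ^ (1 / 4 : ℝ)) ^ 2 := fun x hx => by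
    rw [Real.sqrt_eq_rpow, ← Real.rpow_natCast, ← Real.rpow_mul hx]; norm_num
  rw [hroot _ hΔ₁0] at hb₁
  rw [hroot _ hΔ₂0] at hb₂
  have ha : 0 ≤ Δ₁ ^ (1 / 4 : ℝ) := Real.rpow_nonneg hΔ₁0 _
  have hb : 0 ≤ Δ₂ ^ (1 / 4 : ℝ) := Real.rpow_nonneg hΔ₂0 _
  set a := Δ₁ ^ (1 / 4 : ℝ)
  set b := Δ₂ ^ (1 / 4 : ℝ)
  -- In this case the joint weight, at least `1 - a² - b²`, is positive, which yields the unique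
  -- optimal state.
  by_cases hsmall : a ^ 2 + b ^ 2 < 1
  · obtain ⟨ψ, hψ, huniq, herr⟩ := BroadcastFather.exists_optimal_state hU_N.1 hW hU₁ hV₁ hU₂ hV₂ (by
      by_contra! h
      simp only [← hv] at h
      simp only [h, norm_zero] at hjoint
      simp at hjoint
      linarith)
    refine ⟨U₁, hU₁, U₂, hU₂, d₁, d₂, V₁, V₂, hV₁, hV₂, ψ, hψ, huniq, ?_⟩
    rw [herr, ← hv]
    have : √(1 - ∑ e, ∑ c, ∑ d₁, ∑ d₂, ‖BroadcastFather.jointOverlap U₁ V₁ U₂ V₂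
        (BroadcastFather.amplitudes v e c) d₁ d₂‖ ^ 2) ≤ a + b := by
      refine Real.sqrt_le_iff.2 ⟨by positivity, ?_⟩
      -- `1 - weight ≤ a² + b² ≤ (a + b)²`, so the error is at most `2a + 2b`.
      nlinarith [mul_nonneg ha hb]
    linarith
  -- The decoders found above might give a state orthogonal to the target, so they are discarded.
  -- Here `a + b ≥ 1`, and the bound exceeds the trivial error 2; any protocol with nonzero overlap
  -- serves.
  · obtain ⟨n₁, n₂, V₁, V₂, hV₁, hV₂, h0⟩ := BroadcastFather.exists_jointOverlap_ne_zero hv1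
    obtain ⟨ψ, hψ, huniq, herr⟩ :=
      BroadcastFather.exists_optimal_state hU_N.1 hW (one_mem _) hV₁ (one_mem _) hV₂ h0
    refine ⟨1, one_mem _, 1, one_mem _, n₁, n₂, V₁, V₂, hV₁, hV₂, ψ, hψ, huniq, ?_⟩
    rw [herr]
    have h1 : √(1 - ∑ e, ∑ c, ∑ d₁, ∑ d₂, ‖BroadcastFather.jointOverlap 1 V₁ 1 V₂
        (BroadcastFather.amplitudes (BroadcastFather.transmitted U_N W 1) e c) d₁ d₂‖ ^ 2) ≤ 1 := by
      refine Real.sqrt_le_one.2 (sub_le_self _ ?_)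
      exact Finset.sum_nonneg fun _ _ => Finset.sum_nonneg fun _ _ => Finset.sum_nonneg fun _ _ =>
        Finset.sum_nonneg fun _ _ => by positivity
    have h2 : 1 ≤ a + b := by
      by_contra hlt
      nlinarith [mul_nonneg ha hb]
    linarith
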